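/- **Setting.** A planar 3-RPR manipulator with locked prismatic joints is regarded as a pin-jointed bar-plate framework: a base plate with anchor points $x_1,x_2,x_3\in\mathbb R^2$, a platform plate with anchor points $x_4,x_5,x_6\in\mathbb R^2$, and three legs $x_ix_{i+3}$ ($i=1,2,3$) of fixed non-zero length, pairwise distinct as pairs (base point, platform point). It is non-degenerate if neither the three base points nor the three platform points all coincide. Write $x_k=(a_k,b_k)^{\mathrm T}$. Let $c_0=q_0^2+q_1^2-1$ and let $c_i(q_0,\dots,q_3)$, $i=1,2,3$, be the quadratic polynomial $$\begin{aligned}c_i={}&2a_ia_j(q_1^2-q_0^2)+4(a_ib_j-b_ia_j)q_0q_1+2b_ib_j(q_1^2-q_0^2)+(a_j^2+b_j^2)(q_0^2+q_1^2)-4a_i(q_0q_3+q_1q_2)\\&+4b_i(q_0q_2-q_1q_3)+4a_j(q_0q_3-q_1q_2)-4b_j(q_0q_2+q_1q_3)+a_i^2+b_i^2+4(q_2^2+q_3^2)-\|x_i-x_j\|^2,\quad j=i+3,\end{aligned}$$ which expresses that the $i$-th leg keeps its length when the platform is moved by the displacement with Blaschke–Grünwald parameters $(q_0:q_1:q_2:q_3)$;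 the configuration itself is the solution $(1,0,0,0)$. If $c\in\{1,2,\dots,\infty\}$ denotes the multiplicity over $\mathbb C$ of the solution $(1,0,0,0)$ of $c_0=c_1=c_2=c_3=0$ (length of the local ring; $c=\infty$ iff the configuration belongs to a continuous flexion over $\mathbb C$), its *flexion order* is $c-1$. Flexion order $0$ is called first-order rigid. Let $s=\det(\nabla c_0,\nabla c_1,\nabla c_2,\nabla c_3)$ and $V_1=\{s=0\}$; the configuration corresponds to a *singular point* of $V_1$ if $s=0$ and $\nabla s=0$ at $(1,0,0,0)$. Two realisations $X=(x_1,\dots,x_6)$, $X'=(x_1',\dots,x_6')$ of a non-degenerate manipulator with equal leg lengths form a pair of *Set C* if there are a direct isometry $\alpha$ and an indirect isometry $\beta$ of $\mathbb R^2$ with $\alpha(x_i)=x_i'$ ($i=1,2,3$) and $\beta(x_j)=x_j'$ ($j=4,5,6$), and $x_4,x_5,x_6$ are not collinear. The *averaged configuration* $\bar X$ has the points $\bar x_k=\frac12(x_k+x_k')$; it is assumed to have legs of non-zero length that are pairwise distinct (its base or platform may degenerate). Incongruence of $X$ and $X'$ is not needed. **Parametrisation.** Every pair of Set C can be brought into one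 of the following forms by relabelling the legs, a direct isometry applied to both realisations, a change of the unit length, and translations of $X$ and $X'$ by opposite vectors. Put $x_4=(0,1)^{\mathrm T}$ and let $x_j'=(a_j+d,-b_j)^{\mathrm T}$ for $j=4,5,6$ and $x_i'=x_i$ for $i=1,2,3$. Whenever stated, $x_i=m_i+l_in_i$ with $l_i\in\mathbb R$, where $m_i$ is the midpoint of $x_{i+3}x_{i+3}'$ and $n_i=(b_{i+3}-b_{i+3}',\,a_{i+3}'-a_{i+3})^{\mathrm T}$. Finally, $X$ is rotated about the origin by the rotation with matrix $\frac1{f_0^2+f_1^2}\begin{pmatrix}f_0^2-f_1^2&-2f_0f_1\\2f_0f_1&f_0^2-f_1^2\end{pmatrix}$, $(f_0,f_1)\ne(0,0)$. * Case $(I)$ (glide-reflection): $d\neq0$, $x_5,x_6$ arbitrary, $x_i=m_i+l_in_i$ for $i=1,2,3$. * Case $(II_i)$ (reflection): $d=0$, $b_5b_6\ne0$, $x_i=m_i+l_in_i$ for $i=1,2,3$. * Case $(II_{ii})$: $d=0$, $b_5\ne0$, $x_6=(a_6,0)^{\mathrm T}$, $x_i=m_i+l_in_i$ for $i=1,2$,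 and $x_3=(a_3,b_3)^{\mathrm T}$ arbitrary. * Case $(II_{iii})$: $d=0$, $x_5=(a_5,0)^{\mathrm T}$, $x_6=(a_6,0)^{\mathrm T}$, $x_1=m_1+l_1n_1$, and $x_2=(a_2,b_2)^{\mathrm T}$, $x_3=(a_3,b_3)^{\mathrm T}$ arbitrary. **Theorem.** Let $(X,X')$ be a pair of Set C with averaged configuration $\bar X$ as above. 1. In the cases $(I)$ and $(II_{iii})$, $\bar X$ is in general first-order rigid: there is a non-zero real polynomial in the parameters $(d,f_0,f_1,a_5,b_5,a_6,b_6,l_1,l_2,l_3)$, respectively $(f_0,f_1,a_2,b_2,a_3,b_3,a_5,a_6,l_1)$, such that wherever it does not vanish the parametrised pair is an incongruent pair of Set C in the respective case, its averaged configuration has non-zero, pairwise distinct legs, and this averaged configuration has flexion order $0$. Moreover, $\bar X$ has flexion order at least $1$ iff $f_0=0$ in case $(I)$, and iff $f_0b_2b_3=0$ in case $(II_{iii})$. 2. In the cases $(II_i)$ and $(II_{ii})$, $\bar X$ has flexion order at least $1$. In case $(II_i)$ all six points of $\bar X$ are collinear and $\bar X$ corresponds to a singular point of $V_1$. In case $(II_{ii})$,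 if $\bar X$ does not correspond to a singular point of $V_1$, then $\bar X$ has flexion order at least $2$ iff $$\begin{aligned}P_{II_{ii}}={}&(f_1+2f_0l_2)(2f_1l_1-f_0a_6^2)b_5+4b_5f_0f_1(l_1-l_2)a_6\\&+(f_1+2f_0l_1)\left[f_0(a_5-a_6)^2-2f_1l_2b_5^2-a_5b_5(f_1-2f_0l_2)\right]=0.\end{aligned}$$ -/

import Mathlib

open MvPolynomial

noncomputable section

/-- The Euclidean plane. -/
abbrev Plane : Type := EuclideanSpace ℝ (Fin 2)

/-- A realisation of a planar 3-RPR manipulator with locked prismatic joints, seen as a pin-jointed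
bar-plate framework: `base i` is the base anchor point `x_(i+1)` and `platform i` is the platform
anchor point `x_(i+4)` of the `i`-th leg, `i = 0, 1, 2`. -/
structure Realisation where
  base : Fin 3 → Plane
  platform : Fin 3 → Plane

namespace Realisation

/-- The combinatorial structure of the bar-plate framework is respected: no leg has length zero,
and no two legs coincide. -/
structure HasStructure (X : Realisation) : Prop where
  leg_ne : ∀ i, X.base i ≠ X.platform i
  legs_distinct : ∀ i j, i ≠ j → X.base i ≠ X.base j ∨ X.platform i ≠ X.platform j

/-- A non-degenerate manipulator: moreover neither the base anchor points nor the platform anchor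
points collapse to a single point. -/
structure IsManipulator (X : Realisation) : Prop extends HasStructure X where
  base_nondeg : ∃ i j, X.base i ≠ X.base j
  platform_nondeg : ∃ i j, X.platform i ≠ X.platform j

/-! ### Constraint equations in Blaschke-Gruenwald parameters -/

/-- The equation, in the Blaschke-Gruenwald parameters `q_0, …, q_3` of the platform pose, that
the platform point with moving coordinates `y` has squared distance `r2` from the base point `x`. -/
def legConstraint (x y : Plane) (r2 : ℝ) : MvPolynomial (Fin 4) ℝ :=
  let q0 : MvPolynomial (Fin 4) ℝ := X 0
  let q1 : MvPolynomial (Fin 4) ℝ := X 1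
  let q2 : MvPolynomial (Fin 4) ℝ := X 2
  let q3 : MvPolynomial (Fin 4) ℝ := X 3
  let ai : MvPolynomial (Fin 4) ℝ := C (x 0)
  let bi : MvPolynomial (Fin 4) ℝ := C (x 1)
  let aj : MvPolynomial (Fin 4) ℝ := C (y 0)
  let bj : MvPolynomial (Fin 4) ℝ := C (y 1)
  2 * ai * aj * q1 ^ 2 - 2 * ai * aj * q0 ^ 2 + 4 * ai * bj * q0 * q1
    - 4 * bi * aj * q0 * q1 - 2 * bi * bj * q0 ^ 2 + 2 * bi * bj * q1 ^ 2
    + (aj ^ 2 + bj ^ 2) * (q0 ^ 2 + q1 ^ 2)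
    - 4 * ai * (q0 * q3 + q1 * q2) + 4 * bi * (q0 * q2 - q1 * q3)
    + 4 * aj * (q0 * q3 - q1 * q2) - 4 * bj * (q0 * q2 + q1 * q3)
    + ai ^ 2 + bi ^ 2 + 4 * (q2 ^ 2 + q3 ^ 2) - C r2

/-- The polynomials `c_0, c_1, c_2, c_3` of the direct kinematic problem for the framework whose
plates and leg lengths are those of `X`. The moving frame is chosen such that it coincides with the
fixed frame in the realisation `X`, so that `X` itself is the solution `(1, 0, 0, 0)`. -/
def constraint (X : Realisation) : Fin 4 → MvPolynomial (Fin 4) ℝ :=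
  ![MvPolynomial.X 0 ^ 2 + MvPolynomial.X 1 ^ 2 - 1,
    legConstraint (X.base 0) (X.platform 0) (dist (X.base 0) (X.platform 0) ^ 2),
    legConstraint (X.base 1) (X.platform 1) (dist (X.base 1) (X.platform 1) ^ 2),
    legConstraint (X.base 2) (X.platform 2) (dist (X.base 2) (X.platform 2) ^ 2)]

/-! ### Flexion order -/

/-- The maximal ideal of the point `(1, 0, 0, 0)` in `ℂ[q_0, …, q_3]`. -/
def poseIdeal : Ideal (MvPolynomial (Fin 4) ℂ) :=
  RingHom.ker (MvPolynomial.eval ![(1 : ℂ), 0, 0, 0])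

instance : poseIdeal.IsPrime := by
  unfold poseIdeal
  exact RingHom.ker_isPrime _

/-- The local ring of complex affine 4-space at `(1, 0, 0, 0)`. -/
abbrev PoseRing : Type := Localization.AtPrime poseIdeal

/-- The ideal of `ℂ[q_0, …, q_3]` generated by the constraint polynomials. -/
def constraintIdeal (X : Realisation) : Ideal (MvPolynomial (Fin 4) ℂ) :=
  Ideal.span (Set.range fun i => MvPolynomial.map (algebraMap ℝ ℂ) (X.constraint i))

/-- The number of realisations coinciding at `X`: the multiplicity over `ℂ` of the solution
`(1, 0, 0, 0)` of `c_0 = c_1 = c_2 = c_3 = 0`, i.e. the length of the local ring of the solution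
scheme at this point. It is `⊤` iff the solution is not isolated over `ℂ`. -/
def multiplicity (X : Realisation) : ℕ∞ :=
  Module.length PoseRing
    (PoseRing ⧸ (constraintIdeal X).map (algebraMap (MvPolynomial (Fin 4) ℂ) PoseRing))

/-- The flexion order `c - 1`, where `c` is the multiplicity; it is `⊤` if the realisation belongs
to a continuous flexion over `ℂ`. -/
def flexionOrder (X : Realisation) : ℕ∞ := X.multiplicity - 1

/-- The polynomial `s = det (∇ c_0, ∇ c_1, ∇ c_2, ∇ c_3)`, whose zero set is the variety `V_1`. -/
def rigidityDet (X : Realisation) : MvPolynomial (Fin 4) ℝ :=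
  Matrix.det (Matrix.of fun i j => MvPolynomial.pderiv i (X.constraint j))

/-- The realisation `X` corresponds to a singular point of `V_1`: `s = 0` and `∇ s = 0` there. -/
def IsSingularPoint (X : Realisation) : Prop :=
  MvPolynomial.eval ![1, 0, 0, 0] X.rigidityDet = 0 ∧
    ∀ i, MvPolynomial.eval ![1, 0, 0, 0] (MvPolynomial.pderiv i X.rigidityDet) = 0

/-! ### Pairs of realisations -/

/-- The averaged configuration. -/
def averaged (X X' : Realisation) : Realisation where
  base i := midpoint ℝ (X.base i) (X'.base i)
  platform i := midpoint ℝ (X.platform i) (X'.platform i)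

/-- No isometry of the plane (direct or indirect) maps `X` to `X'`. -/
def Incongruent (X X' : Realisation) : Prop :=
  ¬ ∃ φ : Plane ≃ᵃⁱ[ℝ] Plane,
    (∀ i, φ (X.base i) = X'.base i) ∧ ∀ i, φ (X.platform i) = X'.platform i

end Realisation

/-- Direct (orientation preserving) isometries of the plane. -/
def IsDirect (φ : Plane ≃ᵃⁱ[ℝ] Plane) : Prop :=
  LinearMap.det (φ.linearIsometryEquiv.toLinearEquiv : Plane →ₗ[ℝ] Plane) = 1

/-- Indirect (orientation reversing) isometries of the plane. -/
def IsIndirect (φ : Plane ≃ᵃⁱ[ℝ] Plane) : Prop :=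
  LinearMap.det (φ.linearIsometryEquiv.toLinearEquiv : Plane →ₗ[ℝ] Plane) = -1

namespace Realisation

/-- `X` and `X'` are realisations of one non-degenerate manipulator with locked prismatic joints
which form a pair of Set C. Incongruence is not part of the definition. -/
structure IsSetC (X X' : Realisation) : Prop where
  left : X.IsManipulator
  right : X'.IsManipulator
  legs : ∀ i, dist (X.base i) (X.platform i) = dist (X'.base i) (X'.platform i)
  exists_direct : ∃ α : Plane ≃ᵃⁱ[ℝ] Plane, IsDirect α ∧ ∀ i, α (X.base i) = X'.base i
  exists_indirect : ∃ β : Plane ≃ᵃⁱ[ℝ] Plane, IsIndirect β ∧ ∀ i, β (X.platform i) = X'.platform i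
  not_collinear : ¬ Collinear ℝ (Set.range X.platform)

/-- The pair `(X, X')` takes the form `Z` after a relabelling `σ` of the legs, a change of the
reference frame (a direct isometry `g`) and of the unit length (a factor `k > 0`), and opposite
translations by `t` and `-t`, which do not affect the averaged configuration. -/
def TakesForm (X X' : Realisation) (Z : Realisation × Realisation) : Prop :=
  ∃ (σ : Equiv.Perm (Fin 3)) (g : Plane ≃ᵃⁱ[ℝ] Plane) (k : ℝ) (t : Plane),
    IsDirect g ∧ 0 < k ∧
    (∀ i, k • g (X.base (σ i)) + t = Z.1.base i) ∧
    (∀ i, k • g (X.platform (σ i)) + t = Z.1.platform i) ∧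
    (∀ i, k • g (X'.base (σ i)) - t = Z.2.base i) ∧
    (∀ i, k • g (X'.platform (σ i)) - t = Z.2.platform i)

end Realisation

/-! ### Parametrisation of Set C -/

/-- The planar motion with Blaschke-Gruenwald parameters `(q0 : q1 : q2 : q3)`. -/
def bgTransform (q0 q1 q2 q3 : ℝ) (p : Plane) : Plane :=
  !₂[((q0 ^ 2 - q1 ^ 2) * p 0 - 2 * q0 * q1 * p 1 + (2 * q1 * q2 + 2 * q0 * q3))
      / (q0 ^ 2 + q1 ^ 2),
    (2 * q0 * q1 * p 0 + (q0 ^ 2 - q1 ^ 2) * p 1 + (2 * q1 * q3 - 2 * q0 * q2))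
      / (q0 ^ 2 + q1 ^ 2)]

/-- The glide-reflection along the `x`-axis with translation distance `d` (a reflection if
`d = 0`). -/
def glide (d : ℝ) (p : Plane) : Plane := !₂[p 0 + d, -p 1]

/-- The point `m + l n`, where `m` is the midpoint of `p p'` and
`n = (b - b', a' - a)` for `p = (a, b)`, `p' = (a', b')`. -/
def bisectorPoint (p p' : Plane) (l : ℝ) : Plane :=
  !₂[(p 0 + p' 0) / 2 + l * (p 1 - p' 1), (p 1 + p' 1) / 2 + l * (p' 0 - p 0)]

/-- The pair of realisations with common base `base`, and platforms `platform` and its image under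
the glide-reflection, after the first realisation has been rotated about the origin by
`(f0 : f1 : 0 : 0)`. -/
def glidePair (d f0 f1 : ℝ) (base platform : Fin 3 → Plane) : Realisation × Realisation :=
  (⟨fun i => bgTransform f0 f1 0 0 (base i), fun i => bgTransform f0 f1 0 0 (platform i)⟩,
    ⟨base, fun i => glide d (platform i)⟩)

/-- The parametrised pairs of the glide-reflection case (and, for `d = 0`, of the general
reflection case). -/
def pairI (d f0 f1 a5 b5 a6 b6 l1 l2 l3 : ℝ) : Realisation × Realisation :=
  glidePair d f0 f1
    ![bisectorPoint !₂[0, 1] (glide d !₂[0, 1]) l1,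
      bisectorPoint !₂[a5, b5] (glide d !₂[a5, b5]) l2,
      bisectorPoint !₂[a6, b6] (glide d !₂[a6, b6]) l3]
    ![!₂[0, 1], !₂[a5, b5], !₂[a6, b6]]

/-- The parametrised pairs of the special reflection case. -/
def pairIIii (f0 f1 a3 b3 a5 b5 a6 l1 l2 : ℝ) : Realisation × Realisation :=
  glidePair 0 f0 f1
    ![bisectorPoint !₂[0, 1] (glide 0 !₂[0, 1]) l1,
      bisectorPoint !₂[a5, b5] (glide 0 !₂[a5, b5]) l2,
      !₂[a3, b3]]
    ![!₂[0, 1], !₂[a5, b5], !₂[a6, 0]]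

/-- The parametrised pairs of the very special reflection case. -/
def pairIIiii (f0 f1 a2 b2 a3 b3 a5 a6 l1 : ℝ) : Realisation × Realisation :=
  glidePair 0 f0 f1
    ![bisectorPoint !₂[0, 1] (glide 0 !₂[0, 1]) l1, !₂[a2, b2], !₂[a3, b3]]
    ![!₂[0, 1], !₂[a5, 0], !₂[a6, 0]]

namespace Realisation

/-- Case I (glide-reflection). -/
def IsCaseI (X X' : Realisation) (d f0 f1 a5 b5 a6 b6 l1 l2 l3 : ℝ) : Prop :=
  (f0 ≠ 0 ∨ f1 ≠ 0) ∧ d ≠ 0 ∧ TakesForm X X' (pairI d f0 f1 a5 b5 a6 b6 l1 l2 l3)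

/-- Case II_i (reflection, no platform anchor point is fixed). -/
def IsCaseIIi (X X' : Realisation) (f0 f1 a5 b5 a6 b6 l1 l2 l3 : ℝ) : Prop :=
  (f0 ≠ 0 ∨ f1 ≠ 0) ∧ b5 ≠ 0 ∧ b6 ≠ 0 ∧ TakesForm X X' (pairI 0 f0 f1 a5 b5 a6 b6 l1 l2 l3)

/-- Case II_ii (reflection, exactly the platform anchor point of the third leg is fixed). -/
def IsCaseIIii (X X' : Realisation) (f0 f1 a3 b3 a5 b5 a6 l1 l2 : ℝ) : Prop :=
  (f0 ≠ 0 ∨ f1 ≠ 0) ∧ b5 ≠ 0 ∧ TakesForm X X' (pairIIii f0 f1 a3 b3 a5 b5 a6 l1 l2)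

/-- Case II_iii (reflection, the platform anchor points of the second and third leg are fixed). -/
def IsCaseIIiii (X X' : Realisation) (f0 f1 a2 b2 a3 b3 a5 a6 l1 : ℝ) : Prop :=
  (f0 ≠ 0 ∨ f1 ≠ 0) ∧ TakesForm X X' (pairIIiii f0 f1 a2 b2 a3 b3 a5 a6 l1)

end Realisation

/-- The polynomial `P_{II_ii}`. -/
def polyIIii (f0 f1 a5 b5 a6 l1 l2 : ℝ) : ℝ :=
  (f1 + 2 * f0 * l2) * (2 * f1 * l1 - f0 * a6 ^ 2) * b5
    + 4 * b5 * f0 * f1 * (l1 - l2) * a6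
    + (f1 + 2 * f0 * l1) * (f0 * (a5 - a6) ^ 2 - 2 * f1 * l2 * b5 ^ 2
      - a5 * b5 * (f1 - 2 * f0 * l2))

end

/-! Two algebraic criteria translate the multiplicity into geometry. Modulo the normalisation, a leg
constraint has as its linear part at $(1,0,0,0)$ the line coordinates of the leg applied to
$(q_1,q_2,q_3)$. If these three linear forms are independent, Nakayama's lemma makes the constraints
generate the maximal ideal and the multiplicity is 1. Otherwise a kernel vector is the velocity of a
curve on which all constraints vanish to second order. Thus the flexion order is at least 1 iff
`legMatrix` is singular, i.e. iff the legs lie on concurrent or parallel lines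
(`one_le_flexionOrder_iff`).

The averaged configuration is computed in an adapted frame. The mean of the identity and the
rotation through $2\varphi$ is $\cos\varphi$ times the rotation through $\varphi$, and the mean of a
rotation and a glide-reflection maps the plane into a line. So, up to similarity, the base is scaled
by $f_0$ and the platform points fall on a line parallel to the glide axis (`normalForm`,
`TakesForm.exists_similarity`). In cases $(I)$ and $(II_{iii})$ the determinant then factors into
$f_0$ (to the third power in $(II_{iii})$), quantities that vanish only for a leg of length zero or
a flat platform, and, in case $(I)$, $d^2$ or, in case $(II_{iii})$, $b_2b_3$. In case $(II_i)$
everything lies on the axis; the Jacobian has corank at least 2 there, so its determinant vanishes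
together with its gradient.

In case $(II_{ii})$ two legs lie on the axis and the third has its platform point there. Unless all
six points are on the axis, the only infinitesimal motion is the rotation about this point.
Eliminating the linear terms from the two axial legs leaves a multiple of $q_1^2$ modulo cubic
terms. Its coefficient is $P_{II_{ii}}$ up to non-zero factors: if it does not vanish the
multiplicity is at most 2, and if it does an explicit parabolic curve raises the multiplicity to at
least 3 (`IsTwoLegsOnLine.three_le_multiplicity_iff`).

That the four cases exhaust Set C follows by choosing the frame in which $\beta\alpha^{-1}$ is a
glide-reflection along the first axis. -/

noncomputable section

/-! ### Lengths of quotients of local rings -/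

/-- A strict chain of two proper ideals bounds the length of the quotient from below. -/
theorem three_le_length_of_chain {S : Type*} [CommRing S] {I J K : Ideal S}
    (hJ : I < J) (hK : J < K) (hT : K < ⊤) : 3 ≤ Module.length S (S ⧸ I) := by
  have h1 := Order.coheight_add_one_le hJ
  have h2 := Order.coheight_add_one_le hK
  have h3 := Order.coheight_add_one_le hT
  have e := Module.length_quotient (R := S) (M := S) (N := I)
  rw [e]
  calc (3 : ℕ∞) = 0 + 1 + 1 + 1 := by norm_num
    _ ≤ Order.coheight (⊤ : Ideal S) + 1 + 1 + 1 := by gcongr; exact zero_le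
    _ ≤ Order.coheight K + 1 + 1 := by gcongr
    _ ≤ Order.coheight J + 1 := by gcongr
    _ ≤ _ := h1

/-- The residue field has length one, while a smaller `I` yields the chain from `I` through the
maximal ideal to the unit ideal. -/
theorem two_le_length_iff {S : Type*} [CommRing S] [IsLocalRing S] {I : Ideal S}
    (hI : I ≤ IsLocalRing.maximalIdeal S) :
    2 ≤ Module.length S (S ⧸ I) ↔ I ≠ IsLocalRing.maximalIdeal S := by
  constructor
  · rintro h rfl
    have : Module.length S (S ⧸ IsLocalRing.maximalIdeal S) = 1 := by
      rw [Module.length_eq_one_iff, isSimpleModule_iff_isCoatom]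
      exact (IsLocalRing.maximalIdeal.isMaximal S).out
    rw [this] at h
    exact absurd h (by norm_num)
  · intro h
    have h2 := Order.coheight_add_one_le (lt_of_le_of_ne hI h)
    have h3 := Order.coheight_add_one_le (lt_top_iff_ne_top.2
      (IsLocalRing.maximalIdeal.isMaximal S).ne_top)
    have e := Module.length_quotient (R := S) (M := S) (N := I)
    rw [e]
    calc (2 : ℕ∞) = 0 + 1 + 1 := by norm_num
      _ ≤ Order.coheight (⊤ : Ideal S) + 1 + 1 := by gcongr; exact zero_le
      _ ≤ Order.coheight (IsLocalRing.maximalIdeal S) + 1 := by gcongr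
      _ ≤ _ := h2

/-- The image of the maximal ideal in `S ⧸ I` is spanned by `t` over the residue field, so nothing
lies strictly between `I` and it. An element of a larger ideal outside `I` is `r * t` modulo `I`
with `r` a unit, because non-units kill `t`. -/
theorem length_le_two {S : Type*} [CommRing S] [IsLocalRing S] {I : Ideal S} {t : S}
    (hM : IsLocalRing.maximalIdeal S ≤ I ⊔ Ideal.span {t})
    (ht : ∀ m ∈ IsLocalRing.maximalIdeal S, m * t ∈ I) :
    ¬ 3 ≤ Module.length S (S ⧸ I) := by
  have key : ∀ N : Ideal S, I < N → IsLocalRing.maximalIdeal S ≤ N := by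
    intro N hN
    by_cases hT : N = ⊤
    · rw [hT]; exact le_top
    obtain ⟨x, hxN, hxI⟩ := Set.exists_of_ssubset hN
    have hx := hM (IsLocalRing.le_maximalIdeal hT hxN)
    obtain ⟨i, hi, y, hy, rfl⟩ := Submodule.mem_sup.1 hx
    obtain ⟨r, rfl⟩ := Ideal.mem_span_singleton'.1 hy
    have hr : IsUnit r := by
      by_contra hr
      exact hxI (I.add_mem hi (ht r ((IsLocalRing.mem_maximalIdeal r).2 hr)))
    have hrt : r * t ∈ N := by
      have := N.sub_mem hxN (hN.le hi)
      simpa using this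
    have htN : t ∈ N := (Ideal.unit_mul_mem_iff_mem N hr).1 hrt
    exact hM.trans (sup_le hN.le ((Ideal.span_singleton_le_iff_mem N).2 htN))
  intro h
  have e := Module.length_quotient (R := S) (M := S) (N := I)
  rw [e] at h
  -- Every ideal strictly above `I` contains the maximal ideal, so only the unit ideal can lie
  -- strictly above that.
  have h1 : Order.coheight I ≤ (2 : ℕ) := by
    refine Order.coheight_le_coe_iff.2 fun N hN => ?_
    have h2 : Order.coheight N ≤ (1 : ℕ) := by
      refine Order.coheight_le_coe_iff.2 fun N' hN' => ?_
      have hN'T : N' = ⊤ := by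
        by_contra hT
        have := IsLocalRing.le_maximalIdeal hT
        exact absurd (hN'.trans_le (this.trans (key N hN))) (lt_irrefl _)
      rw [hN'T]
      simp
    exact lt_of_le_of_lt h2 (by norm_num)
  exact absurd (h.trans h1) (by norm_num)

/-- Nakayama is used twice: first `t` generates the maximal ideal modulo `I`, so its square is
generated by `t * t` modulo `I`; as `t * t` is cubic modulo `I`, the square of the maximal ideal is
contained in `I`. -/
theorem not_three_le_length {S : Type*} [CommRing S] [IsLocalRing S] {I : Ideal S} {t : S}
    (hfg : (IsLocalRing.maximalIdeal S).FG)
    (h : IsLocalRing.maximalIdeal S ≤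
      I ⊔ Ideal.span {t} ⊔ IsLocalRing.maximalIdeal S * IsLocalRing.maximalIdeal S)
    (ht : t ∈ IsLocalRing.maximalIdeal S)
    (htt : t * t ∈ I ⊔ IsLocalRing.maximalIdeal S *
      (IsLocalRing.maximalIdeal S * IsLocalRing.maximalIdeal S)) :
    ¬ 3 ≤ Module.length S (S ⧸ I) := by
  have hM : IsLocalRing.maximalIdeal S ≤ I ⊔ Ideal.span {t} :=
    Submodule.le_of_le_smul_of_le_jacobson_bot (I := IsLocalRing.maximalIdeal S)
      hfg (IsLocalRing.maximalIdeal_le_jacobson _) (by simpa using h)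
  have hfg2 : (IsLocalRing.maximalIdeal S * IsLocalRing.maximalIdeal S).FG :=
    Submodule.FG.mul hfg hfg
  have hMM : IsLocalRing.maximalIdeal S * IsLocalRing.maximalIdeal S ≤ I := by
    refine Submodule.le_of_le_smul_of_le_jacobson_bot (I := IsLocalRing.maximalIdeal S)
      hfg2 (IsLocalRing.maximalIdeal_le_jacobson _) ?_
    rw [smul_eq_mul]
    generalize IsLocalRing.maximalIdeal S = M at *
    calc M * M ≤ (I ⊔ Ideal.span {t}) * (I ⊔ Ideal.span {t}) := Ideal.mul_mono hM hM
      _ ≤ I ⊔ Ideal.span {t * t} := by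
        rw [Ideal.mul_le]
        intro r hr q hq
        obtain ⟨i, hi, y, hy, rfl⟩ := Submodule.mem_sup.1 hr
        obtain ⟨j, hj, z, hz, rfl⟩ := Submodule.mem_sup.1 hq
        obtain ⟨y, rfl⟩ := Ideal.mem_span_singleton'.1 hy
        obtain ⟨z, rfl⟩ := Ideal.mem_span_singleton'.1 hz
        refine Submodule.mem_sup.2 ⟨i * (j + z * t) + y * t * j,
          I.add_mem (I.mul_mem_right _ hi) (I.mul_mem_left _ hj), y * z * (t * t),
          Ideal.mem_span_singleton'.2 ⟨_, rfl⟩, by ring⟩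
      _ ≤ _ := sup_le le_sup_left ((Ideal.span_singleton_le_iff_mem _).2 htt)
  exact length_le_two hM fun m hm => hMM (Ideal.mul_mem_mul hm ht)

/-! ### The constraint ideal -/

namespace Realisation

/-- The constraint of a leg reduced modulo the normalisation `q_0 ^ 2 + q_1 ^ 2 = 1`. -/
def legForm (x y : Plane) : MvPolynomial (Fin 4) ℂ :=
  X 0 * (C ((x 0 * y 1 - x 1 * y 0 : ℝ) : ℂ) * X 1 + C ((x 1 - y 1 : ℝ) : ℂ) * X 2
      + C ((y 0 - x 0 : ℝ) : ℂ) * X 3)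
    + C ((x 0 * y 0 + x 1 * y 1 : ℝ) : ℂ) * X 1 ^ 2
    - X 1 * (C ((x 0 + y 0 : ℝ) : ℂ) * X 2 + C ((x 1 + y 1 : ℝ) : ℂ) * X 3) + X 2 ^ 2 + X 3 ^ 2

/-- The normalisation condition over `ℂ`. -/
def normForm : MvPolynomial (Fin 4) ℂ := X 0 ^ 2 + X 1 ^ 2 - 1

theorem dist_sq_plane (x y : Plane) : dist x y ^ 2 = (x 0 - y 0) ^ 2 + (x 1 - y 1) ^ 2 := by
  rw [EuclideanSpace.dist_eq, Real.sq_sqrt (by positivity)]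
  simp [Fin.sum_univ_two, Real.dist_eq, sq_abs]

/-- The constraint vanishes at the given pose, so its constant term is a multiple of $q_0^2+q_1^2-1$
once the pure $q_0^2$ terms are split off. What remains is homogeneous quadratic without $q_0^2$. -/
theorem map_legConstraint (x y : Plane) :
    MvPolynomial.map (algebraMap ℝ ℂ) (legConstraint x y (dist x y ^ 2)) =
      4 * legForm x y +
        C ((y 0 ^ 2 + y 1 ^ 2 - 2 * (x 0 * y 0 + x 1 * y 1) : ℝ) : ℂ) * normForm := by
  rw [dist_sq_plane]
  simp only [legConstraint, legForm, normForm, map_add, map_sub, map_mul, map_pow, map_X, map_C,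
    Complex.coe_algebraMap, map_ofNat, Complex.ofReal_sub, Complex.ofReal_add, Complex.ofReal_mul,
    Complex.ofReal_pow, Complex.ofReal_ofNat]
  ring

theorem map_constraint_zero (Y : Realisation) :
    MvPolynomial.map (algebraMap ℝ ℂ) (Y.constraint 0) = normForm := by
  simp [constraint, normForm]

theorem constraint_succ (Y : Realisation) (i : Fin 3) :
    Y.constraint i.succ =
      legConstraint (Y.base i) (Y.platform i) (dist (Y.base i) (Y.platform i) ^ 2) := by
  fin_cases i <;> rfl

theorem normForm_mem (Y : Realisation) : normForm ∈ constraintIdeal Y :=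
  Ideal.subset_span ⟨0, map_constraint_zero Y⟩

theorem legForm_mem (Y : Realisation) (i : Fin 3) :
    legForm (Y.base i) (Y.platform i) ∈ constraintIdeal Y := by
  have h : MvPolynomial.map (algebraMap ℝ ℂ) (Y.constraint i.succ) ∈ constraintIdeal Y :=
    Ideal.subset_span ⟨i.succ, rfl⟩
  rw [constraint_succ, map_legConstraint] at h
  have h2 := (Ideal.add_mem_iff_left _ (Ideal.mul_mem_left _ _ (normForm_mem Y))).1 h
  have h3 := Ideal.mul_mem_left (constraintIdeal Y) (C (1 / 4 : ℂ)) h2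
  rwa [← mul_assoc, show (C (1 / 4 : ℂ) : MvPolynomial (Fin 4) ℂ) * 4 = 1 by
    rw [show (4 : MvPolynomial (Fin 4) ℂ) = C 4 from (map_ofNat C 4).symm, ← C_mul]; norm_num, one_mul] at h3

theorem constraintIdeal_le (Y : Realisation) {J : Ideal (MvPolynomial (Fin 4) ℂ)}
    (h0 : normForm ∈ J) (h : ∀ i, legForm (Y.base i) (Y.platform i) ∈ J) :
    constraintIdeal Y ≤ J := by
  refine Ideal.span_le.2 ?_
  rintro _ ⟨i, rfl⟩
  induction i using Fin.cases with
  | zero => rw [SetLike.mem_coe]; simpa only [map_constraint_zero] using h0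
  | succ i =>
    rw [SetLike.mem_coe]
    simp only [constraint_succ, map_legConstraint]
    exact J.add_mem (J.mul_mem_left _ (h i)) (J.mul_mem_left _ h0)

theorem mem_poseIdeal {f : MvPolynomial (Fin 4) ℂ} :
    f ∈ poseIdeal ↔ MvPolynomial.eval ![(1 : ℂ), 0, 0, 0] f = 0 := Iff.rfl

theorem X_zero_sub_one_mem : (X 0 - 1 : MvPolynomial (Fin 4) ℂ) ∈ poseIdeal := by
  simp [mem_poseIdeal]

theorem X_one_mem : (X 1 : MvPolynomial (Fin 4) ℂ) ∈ poseIdeal := by simp [mem_poseIdeal]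

theorem X_two_mem : (X 2 : MvPolynomial (Fin 4) ℂ) ∈ poseIdeal := by simp [mem_poseIdeal]

theorem X_three_mem : (X 3 : MvPolynomial (Fin 4) ℂ) ∈ poseIdeal := by simp [mem_poseIdeal]

/-- Modulo `J` every polynomial equals its value at the point, by induction on the polynomial. -/
theorem poseIdeal_le {J : Ideal (MvPolynomial (Fin 4) ℂ)} (h0 : X 0 - 1 ∈ J) (h1 : X 1 ∈ J)
    (h2 : X 2 ∈ J) (h3 : X 3 ∈ J) : poseIdeal ≤ J := by
  intro f hf
  have key : ∀ g : MvPolynomial (Fin 4) ℂ, g - C (MvPolynomial.eval ![(1 : ℂ), 0, 0, 0] g) ∈ J := by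
    intro g
    induction g using MvPolynomial.induction_on with
    | C a => simp
    | add p q hp hq =>
      have := J.add_mem hp hq
      rw [map_add, C_add]
      convert this using 1
      ring
    | mul_X p i hp =>
      have h4 : (X i - C (![(1 : ℂ), 0, 0, 0] i) : MvPolynomial (Fin 4) ℂ) ∈ J := by
        fin_cases i <;> simpa
      rw [map_mul, C_mul, eval_X]
      have := J.add_mem (J.mul_mem_right (X i) hp)
        (J.mul_mem_left (C (MvPolynomial.eval ![(1 : ℂ), 0, 0, 0] p)) h4)
      convert this using 1
      ring
  have := key f
  rwa [mem_poseIdeal.1 hf, C_0, sub_zero] at this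

theorem constraintIdeal_le_poseIdeal (Y : Realisation) : constraintIdeal Y ≤ poseIdeal :=
  constraintIdeal_le Y (by simp [mem_poseIdeal, normForm])
    (fun i => by simp [mem_poseIdeal, legForm])

/-! ### Curves through the point `(1, 0, 0, 0)` -/

/-- Restriction of polynomials to the curve `t ↦ γ t`. -/
def curveHom (γ : Fin 4 → Polynomial ℂ) : MvPolynomial (Fin 4) ℂ →ₐ[ℂ] Polynomial ℂ :=
  MvPolynomial.aeval γ

/-- The polynomials which vanish to order `n` along the curve `γ`. -/
def curveIdeal (γ : Fin 4 → Polynomial ℂ) (n : ℕ) : Ideal (MvPolynomial (Fin 4) ℂ) :=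
  Ideal.comap (curveHom γ) (Ideal.span {Polynomial.X ^ n})

theorem mem_curveIdeal {γ : Fin 4 → Polynomial ℂ} {n : ℕ} {f : MvPolynomial (Fin 4) ℂ} :
    f ∈ curveIdeal γ n ↔ Polynomial.X ^ n ∣ curveHom γ f := by
  rw [curveIdeal, Ideal.mem_comap, Ideal.mem_span_singleton]

theorem curveIdeal_anti (γ : Fin 4 → Polynomial ℂ) {m n : ℕ} (h : m ≤ n) :
    curveIdeal γ n ≤ curveIdeal γ m := fun _ hf =>
  mem_curveIdeal.2 ((pow_dvd_pow _ h).trans (mem_curveIdeal.1 hf))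

theorem X_dvd_curveHom_iff {γ : Fin 4 → Polynomial ℂ}
    (hγ : ∀ i, (γ i).eval 0 = ![(1 : ℂ), 0, 0, 0] i) (f : MvPolynomial (Fin 4) ℂ) :
    Polynomial.X ∣ curveHom γ f ↔ f ∈ poseIdeal := by
  have h : (curveHom γ f).eval 0 = MvPolynomial.eval ![(1 : ℂ), 0, 0, 0] f := by
    have : (Polynomial.evalRingHom 0).comp (curveHom γ).toRingHom =
        MvPolynomial.eval ![(1 : ℂ), 0, 0, 0] := by
      refine MvPolynomial.ringHom_ext (fun r => ?_) (fun i => ?_)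
      · simp [curveHom]
      · simpa [curveHom] using hγ i
    exact RingHom.congr_fun this f
  rw [mem_poseIdeal, ← h, Polynomial.X_dvd_iff, Polynomial.coeff_zero_eq_eval_zero]

/-- Denominators do not vanish at the point, so their restrictions to the curve are prime to the
parameter and cannot change an order of vanishing. Hence non-membership may be tested before
localising. -/
theorem algebraMap_mem_map_curveIdeal {γ : Fin 4 → Polynomial ℂ}
    (hγ : ∀ i, (γ i).eval 0 = ![(1 : ℂ), 0, 0, 0] i) {n : ℕ} {f : MvPolynomial (Fin 4) ℂ}
    (hf : algebraMap _ PoseRing f ∈ (curveIdeal γ n).map (algebraMap _ PoseRing)) :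
    f ∈ curveIdeal γ n := by
  obtain ⟨u, hu, h⟩ := (IsLocalization.algebraMap_mem_map_algebraMap_iff
    poseIdeal.primeCompl PoseRing _ _).1 hf
  rw [mem_curveIdeal, map_mul] at h
  rw [mem_curveIdeal]
  have hu' : ¬ Polynomial.X ∣ curveHom γ u := by
    rw [X_dvd_curveHom_iff hγ]
    exact hu
  exact (Polynomial.prime_X.pow_dvd_of_dvd_mul_left n hu' h)

theorem map_poseIdeal : poseIdeal.map (algebraMap _ PoseRing) = IsLocalRing.maximalIdeal PoseRing :=
  Localization.AtPrime.map_eq_maximalIdeal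

/-- If the constraints vanish to second order along a curve with non-zero velocity then the
multiplicity is at least two. -/
theorem two_le_multiplicity_of_curve (Y : Realisation) {γ : Fin 4 → Polynomial ℂ}
    (hγ : ∀ i, (γ i).eval 0 = ![(1 : ℂ), 0, 0, 0] i) {z : MvPolynomial (Fin 4) ℂ}
    (hz : z ∈ poseIdeal) (hz' : z ∉ curveIdeal γ 2) (h : constraintIdeal Y ≤ curveIdeal γ 2) :
    2 ≤ Y.multiplicity := by
  refine (two_le_length_iff ?_).2 ?_
  · rw [← map_poseIdeal]
    exact Ideal.map_mono (constraintIdeal_le_poseIdeal Y)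
  · intro e
    apply hz'
    apply algebraMap_mem_map_curveIdeal hγ
    apply Ideal.map_mono h
    rw [e, ← map_poseIdeal]
    exact Ideal.mem_map_of_mem _ hz

/-- If the constraints vanish to third order along a curve with non-zero velocity then the
multiplicity is at least three. -/
theorem three_le_multiplicity_of_curve (Y : Realisation) {γ : Fin 4 → Polynomial ℂ}
    (hγ : ∀ i, (γ i).eval 0 = ![(1 : ℂ), 0, 0, 0] i) {z : MvPolynomial (Fin 4) ℂ}
    (hz : z ∈ poseIdeal) (hz' : z ∉ curveIdeal γ 2) (h : constraintIdeal Y ≤ curveIdeal γ 3) :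
    3 ≤ Y.multiplicity := by
  have hz1 : Polynomial.X ∣ curveHom γ z := (X_dvd_curveHom_iff hγ z).2 hz
  have hzz : z * z ∈ curveIdeal γ 2 := by
    rw [mem_curveIdeal, map_mul, pow_two]
    exact mul_dvd_mul hz1 hz1
  have hzz' : z * z ∉ curveIdeal γ 3 := by
    rw [mem_curveIdeal, map_mul]
    rw [mem_curveIdeal] at hz'
    obtain ⟨g, hg⟩ := hz1
    rw [hg] at hz' ⊢
    intro h3
    apply hz'
    rw [show Polynomial.X * g * (Polynomial.X * g) = Polynomial.X ^ 2 * (g * g) by ring,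
      show (Polynomial.X : Polynomial ℂ) ^ 3 = Polynomial.X ^ 2 * Polynomial.X by ring] at h3
    have := (mul_dvd_mul_iff_left (pow_ne_zero 2 Polynomial.X_ne_zero)).1 h3
    rw [pow_two]
    exact mul_dvd_mul_left _ ((Polynomial.prime_X.dvd_or_dvd this).elim id id)
  set ι := algebraMap (MvPolynomial (Fin 4) ℂ) PoseRing
  have h12 : curveIdeal γ 2 ≤ poseIdeal := fun f hf =>
    (X_dvd_curveHom_iff hγ f).1 ((dvd_pow_self _ two_ne_zero).trans (mem_curveIdeal.1 hf))
  -- The element `z * z` separates the constraint ideal from the ideal of order 2, and `z` separates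
  -- the latter from the maximal ideal.
  refine three_le_length_of_chain (J := (curveIdeal γ 2).map ι)
    (K := IsLocalRing.maximalIdeal PoseRing) ?_ ?_
    (lt_top_iff_ne_top.2 (IsLocalRing.maximalIdeal.isMaximal _).ne_top)
  · refine lt_of_le_of_ne (Ideal.map_mono (h.trans (curveIdeal_anti γ (by norm_num)))) ?_
    intro e
    apply hzz'
    apply algebraMap_mem_map_curveIdeal hγ
    apply Ideal.map_mono h
    rw [e]
    exact Ideal.mem_map_of_mem _ hzz
  · refine lt_of_le_of_ne (map_poseIdeal ▸ Ideal.map_mono h12) ?_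
    intro e
    apply hz'
    apply algebraMap_mem_map_curveIdeal hγ
    rw [e, ← map_poseIdeal]
    exact Ideal.mem_map_of_mem _ hz

/-! ### Upper bounds by Nakayama's lemma -/

/-- If the linear parts of the constraints span the cotangent space, then by Nakayama the
constraints generate the maximal ideal. -/
theorem not_two_le_multiplicity (Y : Realisation)
    (h : poseIdeal ≤ constraintIdeal Y ⊔ poseIdeal * poseIdeal) : ¬ 2 ≤ Y.multiplicity := by
  set ι := algebraMap (MvPolynomial (Fin 4) ℂ) PoseRing
  have hle : (constraintIdeal Y).map ι ≤ IsLocalRing.maximalIdeal PoseRing := by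
    rw [← map_poseIdeal]
    exact Ideal.map_mono (constraintIdeal_le_poseIdeal Y)
  intro h2
  refine (two_le_length_iff hle).1 h2 (le_antisymm hle ?_)
  have h3 := Ideal.map_mono (f := ι) h
  rw [Ideal.map_sup, Ideal.map_mul, map_poseIdeal] at h3
  refine Submodule.le_of_le_smul_of_le_jacobson_bot (I := IsLocalRing.maximalIdeal PoseRing)
    ?_ (IsLocalRing.maximalIdeal_le_jacobson _) (by simpa using h3)
  rw [← map_poseIdeal]
  exact ((isNoetherianRing_iff_ideal_fg _).1 inferInstance poseIdeal).map ι

theorem not_three_le_multiplicity (Y : Realisation) {t : MvPolynomial (Fin 4) ℂ}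
    (ht : t ∈ poseIdeal)
    (h : poseIdeal ≤ constraintIdeal Y ⊔ Ideal.span {t} ⊔ poseIdeal * poseIdeal)
    (ht2 : t * t ∈ constraintIdeal Y ⊔ poseIdeal * (poseIdeal * poseIdeal)) :
    ¬ 3 ≤ Y.multiplicity := by
  set ι := algebraMap (MvPolynomial (Fin 4) ℂ) PoseRing
  refine not_three_le_length (t := ι t) ?_ ?_ ?_ ?_
  · rw [← map_poseIdeal]
    exact ((isNoetherianRing_iff_ideal_fg _).1 inferInstance poseIdeal).map ι
  · have h3 := Ideal.map_mono (f := ι) h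
    rwa [Ideal.map_sup, Ideal.map_sup, Ideal.map_mul, map_poseIdeal, Ideal.map_span,
      Set.image_singleton] at h3
  · rw [← map_poseIdeal]
    exact Ideal.mem_map_of_mem _ ht
  · have := Ideal.mem_map_of_mem ι ht2
    rwa [map_mul, Ideal.map_sup, Ideal.map_mul, Ideal.map_mul, map_poseIdeal] at this

/-! ### First-order rigidity -/

/-- The line coordinates of the legs. -/
def legMatrix (Y : Realisation) : Matrix (Fin 3) (Fin 3) ℝ :=
  Matrix.of fun i => ![Y.base i 0 * Y.platform i 1 - Y.base i 1 * Y.platform i 0,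
    Y.base i 1 - Y.platform i 1, Y.platform i 0 - Y.base i 0]

theorem C_real_mul_mem {J : Ideal (MvPolynomial (Fin 4) ℂ)} {r : ℝ} (hr : r ≠ 0)
    {f : MvPolynomial (Fin 4) ℂ} : C (r : ℂ) * f ∈ J ↔ f ∈ J :=
  Ideal.unit_mul_mem_iff_mem J
    ((isUnit_iff_ne_zero.2 (Complex.ofReal_ne_zero.2 hr)).map (C : ℂ →+* MvPolynomial (Fin 4) ℂ))

theorem mem_sup_sq_of_mul {I P : Ideal (MvPolynomial (Fin 4) ℂ)} {f g : MvPolynomial (Fin 4) ℂ}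
    (hf : f ∈ P) (hg : g ∈ P) : f * g ∈ I ⊔ P * P :=
  Ideal.mem_sup_right (Ideal.mul_mem_mul hf hg)

/-- The normalisation is $2(q_0-1)+(q_0-1)^2+q_1^2$, so it eliminates $q_0-1$ to first order. -/
theorem X_zero_sub_one_mem_sup (Y : Realisation) :
    (X 0 - 1 : MvPolynomial (Fin 4) ℂ) ∈ constraintIdeal Y ⊔ poseIdeal * poseIdeal := by
  have h : (C (((2 : ℝ) : ℂ)) * (X 0 - 1) : MvPolynomial (Fin 4) ℂ) =
      normForm - (X 0 - 1) * (X 0 - 1) - X 1 * X 1 := by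
    rw [show (C (((2 : ℝ) : ℂ)) : MvPolynomial (Fin 4) ℂ) = 2 by
      rw [Complex.ofReal_ofNat]; exact map_ofNat C 2, normForm]
    ring
  rw [← C_real_mul_mem (two_ne_zero (α := ℝ)), h]
  exact sub_mem (sub_mem (Ideal.mem_sup_left (normForm_mem Y))
    (mem_sup_sq_of_mul X_zero_sub_one_mem X_zero_sub_one_mem))
    (mem_sup_sq_of_mul X_one_mem X_one_mem)

/-- The rows of `legMatrix` are the linear parts of the leg constraints; all other terms are
products of two elements vanishing at the pose. -/
theorem legMatrix_mulVec_mem (Y : Realisation) (i : Fin 3) :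
    ((Y.legMatrix.map fun r => (C (r : ℂ) : MvPolynomial (Fin 4) ℂ)).mulVec ![X 1, X 2, X 3]) i ∈
      constraintIdeal Y ⊔ poseIdeal * poseIdeal := by
  set J := constraintIdeal Y ⊔ poseIdeal * poseIdeal
  set L := ((Y.legMatrix.map fun r => (C (r : ℂ) : MvPolynomial (Fin 4) ℂ)).mulVec
    ![X 1, X 2, X 3]) i with hL
  have hLe : L = C ((Y.base i 0 * Y.platform i 1 - Y.base i 1 * Y.platform i 0 : ℝ) : ℂ) * X 1
      + C ((Y.base i 1 - Y.platform i 1 : ℝ) : ℂ) * X 2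
      + C ((Y.platform i 0 - Y.base i 0 : ℝ) : ℂ) * X 3 := by
    rw [hL]
    simp [Matrix.mulVec, dotProduct, Fin.sum_univ_three, legMatrix]
  have hLP : L ∈ poseIdeal := by
    rw [hLe]
    exact add_mem (add_mem (Ideal.mul_mem_left _ _ X_one_mem) (Ideal.mul_mem_left _ _ X_two_mem))
      (Ideal.mul_mem_left _ _ X_three_mem)
  have h : L = legForm (Y.base i) (Y.platform i) - (X 0 - 1) * L
      - X 1 * (C ((Y.base i 0 * Y.platform i 0 + Y.base i 1 * Y.platform i 1 : ℝ) : ℂ) * X 1)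
      + X 1 * (C ((Y.base i 0 + Y.platform i 0 : ℝ) : ℂ) * X 2
        + C ((Y.base i 1 + Y.platform i 1 : ℝ) : ℂ) * X 3) - X 2 * X 2 - X 3 * X 3 := by
    rw [hLe, legForm]
    ring
  rw [h]
  have e1 := Ideal.mem_sup_left (T := poseIdeal * poseIdeal) (legForm_mem Y i)
  refine sub_mem (sub_mem (add_mem (sub_mem (sub_mem e1 ?_) ?_) ?_) ?_) ?_ <;>
    apply mem_sup_sq_of_mul
  · exact X_zero_sub_one_mem
  · exact hLP
  · exact X_one_mem
  · exact Ideal.mul_mem_left _ _ X_one_mem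
  · exact X_one_mem
  · exact add_mem (Ideal.mul_mem_left _ _ X_two_mem) (Ideal.mul_mem_left _ _ X_three_mem)
  · exact X_two_mem
  · exact X_two_mem
  · exact X_three_mem
  · exact X_three_mem

/-- Multiplying the linear parts by the adjugate isolates the determinant times each of
$q_1,q_2,q_3$; an invertible determinant thus puts all coordinates into the constraint ideal to
first order. -/
theorem det_legMatrix_eq_zero_of_two_le_multiplicity (Y : Realisation)
    (h : 2 ≤ Y.multiplicity) : Y.legMatrix.det = 0 := by
  by_contra hdet
  refine not_two_le_multiplicity Y ?_ h
  set N := Y.legMatrix.map fun r => (C (r : ℂ) : MvPolynomial (Fin 4) ℂ) with hN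
  have hNdet : N.det = C ((Y.legMatrix.det : ℝ) : ℂ) :=
    (RingHom.map_det ((C : ℂ →+* MvPolynomial (Fin 4) ℂ).comp Complex.ofRealHom) Y.legMatrix).symm
  have key : ∀ k, (![X 1, X 2, X 3] : Fin 3 → MvPolynomial (Fin 4) ℂ) k ∈
      constraintIdeal Y ⊔ poseIdeal * poseIdeal := by
    intro k
    rw [← C_real_mul_mem hdet, ← hNdet]
    have h1 : N.adjugate.mulVec (N.mulVec ![X 1, X 2, X 3]) =
        N.det • (![X 1, X 2, X 3] : Fin 3 → MvPolynomial (Fin 4) ℂ) := by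
      rw [Matrix.mulVec_mulVec, Matrix.adjugate_mul, Matrix.smul_mulVec, Matrix.one_mulVec]
    have h2 := congrFun h1 k
    rw [Pi.smul_apply, smul_eq_mul] at h2
    rw [← h2]
    rw [Matrix.mulVec, dotProduct]
    exact Ideal.sum_mem _ fun i _ => Ideal.mul_mem_left _ _ (legMatrix_mulVec_mem Y i)
  exact poseIdeal_le (X_zero_sub_one_mem_sup Y) (key 0) (key 1) (key 2)

theorem not_X_sq_dvd_of_coeff_one {f : Polynomial ℂ} (h : f.coeff 1 ≠ 0) :
    ¬ Polynomial.X ^ 2 ∣ f := fun hd =>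
  h (Polynomial.X_pow_dvd_iff.1 hd 1 (by norm_num))

/-- A kernel vector `v` is the velocity of the straight line $(1, tv)$, along which the linear terms
of all constraints cancel. -/
theorem two_le_multiplicity_of_det_legMatrix (Y : Realisation) (h : Y.legMatrix.det = 0) :
    2 ≤ Y.multiplicity := by
  obtain ⟨v, hv, hMv⟩ := Matrix.exists_mulVec_eq_zero_iff.2 h
  obtain ⟨k, hk⟩ := Function.ne_iff.1 hv
  set γ : Fin 4 → Polynomial ℂ := Fin.cons 1 fun i => Polynomial.C (v i : ℂ) * Polynomial.X with hγ
  have g0 : γ 0 = 1 := rfl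
  have g1 : γ 1 = Polynomial.C (v 0 : ℂ) * Polynomial.X := rfl
  have g2 : γ 2 = Polynomial.C (v 1 : ℂ) * Polynomial.X := rfl
  have g3 : γ 3 = Polynomial.C (v 2 : ℂ) * Polynomial.X := rfl
  refine two_le_multiplicity_of_curve Y (γ := γ) (z := X k.succ) ?_ ?_ ?_
    (constraintIdeal_le Y ?_ fun i => ?_)
  · intro i
    fin_cases i <;> simp [g0, g1, g2, g3]
  · fin_cases k
    exacts [X_one_mem, X_two_mem, X_three_mem]
  · rw [mem_curveIdeal]
    apply not_X_sq_dvd_of_coeff_one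
    have : curveHom γ (X k.succ) = Polynomial.C (v k : ℂ) * Polynomial.X := by
      simp [curveHom, hγ]
    rw [this, Polynomial.coeff_C_mul, Polynomial.coeff_X_one, mul_one]
    simpa using hk
  · rw [mem_curveIdeal]
    refine ⟨Polynomial.C (v 0 : ℂ) ^ 2, ?_⟩
    simp only [curveHom, normForm, map_add, map_sub, map_pow, map_one, aeval_X, g0, g1]
    ring
  · rw [mem_curveIdeal]
    have h1 := congrFun hMv i
    simp only [Matrix.mulVec, dotProduct, Fin.sum_univ_three, legMatrix, Matrix.of_apply,
      Matrix.cons_val, Pi.zero_apply] at h1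
    have h2 := congrArg (fun r : ℝ => Polynomial.C (r : ℂ)) h1
    simp only [Complex.ofReal_add, Complex.ofReal_sub, Complex.ofReal_mul, Complex.ofReal_zero,
      map_add, map_sub, map_mul, map_zero] at h2
    refine ⟨Polynomial.C ((Y.base i 0 * Y.platform i 0 + Y.base i 1 * Y.platform i 1 : ℝ) : ℂ)
      * Polynomial.C (v 0 : ℂ) ^ 2 - Polynomial.C (v 0 : ℂ) *
      (Polynomial.C ((Y.base i 0 + Y.platform i 0 : ℝ) : ℂ) * Polynomial.C (v 1 : ℂ)
      + Polynomial.C ((Y.base i 1 + Y.platform i 1 : ℝ) : ℂ) * Polynomial.C (v 2 : ℂ))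
      + Polynomial.C (v 1 : ℂ) ^ 2 + Polynomial.C (v 2 : ℂ) ^ 2, ?_⟩
    simp only [curveHom, legForm, map_add, map_sub, map_mul, map_pow, aeval_X, aeval_C, g0, g1, g2,
      g3, Polynomial.algebraMap_eq, Complex.ofReal_add, Complex.ofReal_sub, Complex.ofReal_mul]
    linear_combination Polynomial.X * h2

theorem two_le_multiplicity_iff (Y : Realisation) :
    2 ≤ Y.multiplicity ↔ Y.legMatrix.det = 0 :=
  ⟨det_legMatrix_eq_zero_of_two_le_multiplicity Y, two_le_multiplicity_of_det_legMatrix Y⟩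

/-- The truncated subtraction in `ℕ∞` is harmless here, also for infinite multiplicity. -/
theorem one_le_flexionOrder_iff (Y : Realisation) :
    1 ≤ Y.flexionOrder ↔ Y.legMatrix.det = 0 := by
  rw [← two_le_multiplicity_iff, flexionOrder]
  induction Y.multiplicity using ENat.recTopCoe with
  | top => simp
  | coe n => norm_cast; omega

theorem two_le_flexionOrder_iff (Y : Realisation) :
    2 ≤ Y.flexionOrder ↔ 3 ≤ Y.multiplicity := by
  rw [flexionOrder]
  induction Y.multiplicity using ENat.recTopCoe with
  | top => simp
  | coe n => norm_cast; omega

/-! ### Second-order flexes of two collinear legs through the third platform point -/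

/-- The first two legs lie on a line through the third platform point `(x, y)` with direction
`(n1, n2)`; the third base point is `(x + D1, y + D2)`. -/
structure IsTwoLegsOnLine (Y : Realisation) (σ : Equiv.Perm (Fin 3))
    (x y n1 n2 D1 D2 s1 s2 p1 p2 : ℝ) : Prop where
  base0 : Y.base (σ 0) = !₂[x + s1 * n1, y + s1 * n2]
  base1 : Y.base (σ 1) = !₂[x + s2 * n1, y + s2 * n2]
  base2 : Y.base (σ 2) = !₂[x + D1, y + D2]
  platform0 : Y.platform (σ 0) = !₂[x + p1 * n1, y + p1 * n2]
  platform1 : Y.platform (σ 1) = !₂[x + p2 * n1, y + p2 * n2]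
  platform2 : Y.platform (σ 2) = !₂[x, y]

/-- The reduced leg constraint in coordinates of the pose adapted to the point `(x, y)`. -/
theorem legForm_shift (x y B1 B2 P1 P2 : ℝ) :
    legForm !₂[x + B1, y + B2] !₂[x + P1, y + P2] =
      X 0 * (C ((B1 * P2 - B2 * P1 : ℝ) : ℂ) * X 1
          + C ((B2 - P2 : ℝ) : ℂ) * (X 2 - C (x : ℂ) * X 1)
          + C ((P1 - B1 : ℝ) : ℂ) * (X 3 - C (y : ℂ) * X 1))
        + C ((B1 * P1 + B2 * P2 : ℝ) : ℂ) * X 1 ^ 2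
        - X 1 * (C ((B1 + P1 : ℝ) : ℂ) * (X 2 - C (x : ℂ) * X 1)
          + C ((B2 + P2 : ℝ) : ℂ) * (X 3 - C (y : ℂ) * X 1))
        + (X 2 - C (x : ℂ) * X 1) ^ 2 + (X 3 - C (y : ℂ) * X 1) ^ 2 := by
  simp only [legForm, Complex.ofReal_add, Complex.ofReal_sub, Complex.ofReal_mul, C_add, C_sub,
    C_mul, Matrix.cons_val]
  ring

/-- The differences $q_2-xq_1$ and $q_3-yq_1$ measure, to first order, the displacement of the
platform point at $(x,y)$. A leg line through $(x,y)$ has no moment about it, so besides these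
differences only $q_1^2$ survives. -/
theorem legForm_on_line (x y n1 n2 s p : ℝ) :
    legForm !₂[x + s * n1, y + s * n2] !₂[x + p * n1, y + p * n2] =
      X 0 * (C ((s - p : ℝ) : ℂ) * (C (n2 : ℂ) * (X 2 - C (x : ℂ) * X 1)
          - C (n1 : ℂ) * (X 3 - C (y : ℂ) * X 1)))
        + C ((s * p : ℝ) : ℂ) * C ((n1 ^ 2 + n2 ^ 2 : ℝ) : ℂ) * X 1 ^ 2
        - C ((s + p : ℝ) : ℂ) * X 1 * (C (n1 : ℂ) * (X 2 - C (x : ℂ) * X 1)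
          + C (n2 : ℂ) * (X 3 - C (y : ℂ) * X 1))
        + (X 2 - C (x : ℂ) * X 1) ^ 2 + (X 3 - C (y : ℂ) * X 1) ^ 2 := by
  rw [legForm_shift]
  simp only [Complex.ofReal_add, Complex.ofReal_sub, Complex.ofReal_mul, C_add, C_sub,
    C_mul, Complex.ofReal_pow, C_pow]
  ring

theorem legForm_through_platform (x y D1 D2 : ℝ) :
    legForm !₂[x + D1, y + D2] !₂[x, y] =
      X 0 * (C (D2 : ℂ) * (X 2 - C (x : ℂ) * X 1) - C (D1 : ℂ) * (X 3 - C (y : ℂ) * X 1))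
        - X 1 * (C (D1 : ℂ) * (X 2 - C (x : ℂ) * X 1) + C (D2 : ℂ) * (X 3 - C (y : ℂ) * X 1))
        + (X 2 - C (x : ℂ) * X 1) ^ 2 + (X 3 - C (y : ℂ) * X 1) ^ 2 := by
  have h := legForm_shift x y D1 D2 0 0
  simp only [add_zero, mul_zero, sub_zero, zero_sub, Complex.ofReal_zero, C_0, zero_mul,
    Complex.ofReal_neg, C_neg] at h
  rw [h]
  ring

theorem X_two_sub_mem (x : ℝ) :
    (X 2 - C (x : ℂ) * X 1 : MvPolynomial (Fin 4) ℂ) ∈ poseIdeal :=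
  sub_mem X_two_mem (Ideal.mul_mem_left _ _ X_one_mem)

theorem X_three_sub_mem (y : ℝ) :
    (X 3 - C (y : ℂ) * X 1 : MvPolynomial (Fin 4) ℂ) ∈ poseIdeal :=
  sub_mem X_three_mem (Ideal.mul_mem_left _ _ X_one_mem)

/-- A factor that is of second order modulo the constraints raises a product to third order. -/
theorem mul_mem_sup_cube {I P : Ideal (MvPolynomial (Fin 4) ℂ)} {f g : MvPolynomial (Fin 4) ℂ}
    (hf : f ∈ P) (hg : g ∈ I ⊔ P * P) : f * g ∈ I ⊔ P * (P * P) := by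
  obtain ⟨i, hi, q, hq, rfl⟩ := Submodule.mem_sup.1 hg
  rw [mul_add]
  exact add_mem (Ideal.mem_sup_left (I.mul_mem_left _ hi))
    (Ideal.mem_sup_right (Ideal.mul_mem_mul hf hq))

namespace IsTwoLegsOnLine

variable {Y : Realisation} {σ : Equiv.Perm (Fin 3)} {x y n1 n2 D1 D2 s1 s2 p1 p2 : ℝ}

/-- The first and third legs pass through $(x,y)$ in independent directions, so the platform point
there is fixed to first order: Cramer's rule with determinant $n_1D_2-n_2D_1$. -/
theorem shifted_mem (h : IsTwoLegsOnLine Y σ x y n1 n2 D1 D2 s1 s2 p1 p2) (h1 : s1 - p1 ≠ 0)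
    (hD : n1 * D2 - n2 * D1 ≠ 0) :
    X 2 - C (x : ℂ) * X 1 ∈ constraintIdeal Y ⊔ poseIdeal * poseIdeal ∧
      X 3 - C (y : ℂ) * X 1 ∈ constraintIdeal Y ⊔ poseIdeal * poseIdeal := by
  have e0 := legForm_mem Y (σ 0)
  have e2 := legForm_mem Y (σ 2)
  rw [h.base0, h.platform0, legForm_on_line] at e0
  rw [h.base2, h.platform2, legForm_through_platform] at e2
  have hz2 := X_two_sub_mem x
  have hz3 := X_three_sub_mem y
  set z2 : MvPolynomial (Fin 4) ℂ := X 2 - C (x : ℂ) * X 1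
  set z3 : MvPolynomial (Fin 4) ℂ := X 3 - C (y : ℂ) * X 1
  have hn : C (n2 : ℂ) * z2 - C (n1 : ℂ) * z3 ∈ constraintIdeal Y ⊔ poseIdeal * poseIdeal := by
    rw [← C_real_mul_mem h1]
    have hr : X 1 * (C ((s1 * p1 : ℝ) : ℂ) * C ((n1 ^ 2 + n2 ^ 2 : ℝ) : ℂ) * X 1)
        + (X 0 - 1) * (C ((s1 - p1 : ℝ) : ℂ) * (C (n2 : ℂ) * z2 - C (n1 : ℂ) * z3))
        - X 1 * (C ((s1 + p1 : ℝ) : ℂ) * (C (n1 : ℂ) * z2 + C (n2 : ℂ) * z3))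
        + z2 * z2 + z3 * z3 ∈ constraintIdeal Y ⊔ poseIdeal * poseIdeal := by
      refine add_mem (add_mem (sub_mem (add_mem ?_ ?_) ?_) (mem_sup_sq_of_mul hz2 hz2))
        (mem_sup_sq_of_mul hz3 hz3)
      · exact mem_sup_sq_of_mul X_one_mem (Ideal.mul_mem_left _ _ X_one_mem)
      · exact mem_sup_sq_of_mul X_zero_sub_one_mem (Ideal.mul_mem_left _ _
          (sub_mem (Ideal.mul_mem_left _ _ hz2) (Ideal.mul_mem_left _ _ hz3)))
      · exact mem_sup_sq_of_mul X_one_mem (Ideal.mul_mem_left _ _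
          (add_mem (Ideal.mul_mem_left _ _ hz2) (Ideal.mul_mem_left _ _ hz3)))
    convert sub_mem (Ideal.mem_sup_left (T := poseIdeal * poseIdeal) e0) hr using 1
    ring
  have hd : C (D2 : ℂ) * z2 - C (D1 : ℂ) * z3 ∈ constraintIdeal Y ⊔ poseIdeal * poseIdeal := by
    have hr : (X 0 - 1) * (C (D2 : ℂ) * z2 - C (D1 : ℂ) * z3)
        - X 1 * (C (D1 : ℂ) * z2 + C (D2 : ℂ) * z3)
        + z2 * z2 + z3 * z3 ∈ constraintIdeal Y ⊔ poseIdeal * poseIdeal := by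
      refine add_mem (add_mem (sub_mem ?_ ?_) (mem_sup_sq_of_mul hz2 hz2))
        (mem_sup_sq_of_mul hz3 hz3)
      · exact mem_sup_sq_of_mul X_zero_sub_one_mem
          (sub_mem (Ideal.mul_mem_left _ _ hz2) (Ideal.mul_mem_left _ _ hz3))
      · exact mem_sup_sq_of_mul X_one_mem
          (add_mem (Ideal.mul_mem_left _ _ hz2) (Ideal.mul_mem_left _ _ hz3))
    convert sub_mem (Ideal.mem_sup_left (T := poseIdeal * poseIdeal) e2) hr using 1
    ring
  constructor
  · rw [← C_real_mul_mem hD]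
    convert sub_mem (Ideal.mul_mem_left _ (C (n1 : ℂ)) hd) (Ideal.mul_mem_left _ (C (D1 : ℂ)) hn)
      using 1
    simp only [Complex.ofReal_sub, Complex.ofReal_mul, C_sub, C_mul]
    ring
  · rw [← C_real_mul_mem hD]
    convert sub_mem (Ideal.mul_mem_left _ (C (n2 : ℂ)) hd) (Ideal.mul_mem_left _ (C (D2 : ℂ)) hn)
      using 1
    simp only [Complex.ofReal_sub, Complex.ofReal_mul, C_sub, C_mul]
    ring

/-- The relation is the Euler–Savary condition that $1/p-1/s$ agrees for both legs, cleared of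
denominators. If it fails, eliminating the linear term from the two collinear legs expresses $q_1^2$
by cubic terms modulo the constraints, with $q_1$ spanning the remaining tangent direction. -/
theorem eq_of_three_le_multiplicity (h : IsTwoLegsOnLine Y σ x y n1 n2 D1 D2 s1 s2 p1 p2)
    (h1 : s1 - p1 ≠ 0) (hD : n1 * D2 - n2 * D1 ≠ 0) (hm : 3 ≤ Y.multiplicity) :
    s1 * p1 * (s2 - p2) = s2 * p2 * (s1 - p1) := by
  by_contra hne
  have hn : n1 ^ 2 + n2 ^ 2 ≠ 0 := by
    intro h0
    have h2 : n1 = 0 := by nlinarith [sq_nonneg n1, sq_nonneg n2]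
    have h3 : n2 = 0 := by nlinarith [sq_nonneg n1, sq_nonneg n2]
    exact hD (by rw [h2, h3]; ring)
  obtain ⟨hz2, hz3⟩ := h.shifted_mem h1 hD
  have hp2 := X_two_sub_mem x
  have hp3 := X_three_sub_mem y
  refine not_three_le_multiplicity Y (t := X 1) X_one_mem ?_ ?_ hm
  · have hle : constraintIdeal Y ⊔ poseIdeal * poseIdeal ≤
        constraintIdeal Y ⊔ Ideal.span {X 1} ⊔ poseIdeal * poseIdeal :=
      sup_le_sup_right le_sup_left _
    have hx1 : (X 1 : MvPolynomial (Fin 4) ℂ) ∈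
        constraintIdeal Y ⊔ Ideal.span {X 1} ⊔ poseIdeal * poseIdeal :=
      Ideal.mem_sup_left (Ideal.mem_sup_right (Ideal.mem_span_singleton_self _))
    refine poseIdeal_le (hle (X_zero_sub_one_mem_sup Y)) hx1 ?_ ?_
    · simpa using add_mem (hle hz2) (Ideal.mul_mem_left _ (C (x : ℂ)) hx1)
    · simpa using add_mem (hle hz3) (Ideal.mul_mem_left _ (C (y : ℂ)) hx1)
  · have e0 := legForm_mem Y (σ 0)
    have e1 := legForm_mem Y (σ 1)
    rw [h.base0, h.platform0, legForm_on_line] at e0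
    rw [h.base1, h.platform1, legForm_on_line] at e1
    set z2 : MvPolynomial (Fin 4) ℂ := X 2 - C (x : ℂ) * X 1
    set z3 : MvPolynomial (Fin 4) ℂ := X 3 - C (y : ℂ) * X 1
    rw [← C_real_mul_mem (mul_ne_zero (sub_ne_zero.2 hne) hn)]
    -- These are the quadratic terms left by the elimination, apart from $q_1^2$. Each contains a
    -- shifted coordinate, which is itself of second order modulo the constraints.
    have hr : C (((s1 + p1) * (s2 - p2) - (s2 + p2) * (s1 - p1) : ℝ) : ℂ) *
          (C (n1 : ℂ) * (X 1 * z2) + C (n2 : ℂ) * (X 1 * z3))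
        - C (((s2 - p2) - (s1 - p1) : ℝ) : ℂ) * (z2 * z2 + z3 * z3) ∈
        constraintIdeal Y ⊔ poseIdeal * (poseIdeal * poseIdeal) := by
      refine sub_mem (Ideal.mul_mem_left _ _ (add_mem (Ideal.mul_mem_left _ _ ?_)
        (Ideal.mul_mem_left _ _ ?_))) (Ideal.mul_mem_left _ _ (add_mem ?_ ?_))
      · exact mul_mem_sup_cube X_one_mem hz2
      · exact mul_mem_sup_cube X_one_mem hz3
      · exact mul_mem_sup_cube hp2 hz2
      · exact mul_mem_sup_cube hp3 hz3
    have hg := sub_mem (Ideal.mul_mem_left _ (C ((s2 - p2 : ℝ) : ℂ)) e0)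
      (Ideal.mul_mem_left _ (C ((s1 - p1 : ℝ) : ℂ)) e1)
    convert add_mem (Ideal.mem_sup_left (T := poseIdeal * (poseIdeal * poseIdeal)) hg) hr using 1
    simp only [Complex.ofReal_add, Complex.ofReal_sub, Complex.ofReal_mul, C_add, C_sub, C_mul]
    ring

/-- The rotation about $(x,y)$ is corrected at second order by moving the platform point
orthogonally to the third leg. One scalar `τ` is available; it is fixed by the first leg, and the
Euler–Savary relation makes it serve the second. -/
theorem three_le_multiplicity (h : IsTwoLegsOnLine Y σ x y n1 n2 D1 D2 s1 s2 p1 p2)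
    (h1 : s1 - p1 ≠ 0) (hD : n1 * D2 - n2 * D1 ≠ 0)
    (he : s1 * p1 * (s2 - p2) = s2 * p2 * (s1 - p1)) : 3 ≤ Y.multiplicity := by
  -- This solves the $t^2$-coefficient of the first leg constraint.
  set τ : ℝ := s1 * p1 * (n1 ^ 2 + n2 ^ 2) / ((s1 - p1) * (n1 * D2 - n2 * D1)) with hτ
  have hτ1 : (s1 - p1) * (τ * (n2 * D1 - n1 * D2)) + s1 * p1 * (n1 ^ 2 + n2 ^ 2) = 0 := by
    rw [hτ]
    field_simp
    ring
  have hτ2 : (s2 - p2) * (τ * (n2 * D1 - n1 * D2)) + s2 * p2 * (n1 ^ 2 + n2 ^ 2) = 0 := by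
    have : (s1 - p1) * ((s2 - p2) * (τ * (n2 * D1 - n1 * D2)) + s2 * p2 * (n1 ^ 2 + n2 ^ 2)) = 0 := by
      linear_combination (s2 - p2) * hτ1 - (n1 ^ 2 + n2 ^ 2) * he
    exact (mul_eq_zero.1 this).resolve_left h1
  let κ : ℝ → Polynomial ℂ := fun r => Polynomial.C (r : ℂ)
  let T : Polynomial ℂ := Polynomial.X
  -- The term $-t^2/2$ satisfies the normalisation up to $t^4/4$.
  set γ : Fin 4 → Polynomial ℂ := ![1 - κ (1 / 2) * T ^ 2, T, κ x * T + κ (τ * D1) * T ^ 2,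
    κ y * T + κ (τ * D2) * T ^ 2] with hγ
  have g0 : curveHom γ (X 0) = 1 - κ (1 / 2) * T ^ 2 := by simp [curveHom, hγ]
  have g1 : curveHom γ (X 1) = T := by simp [curveHom, hγ]
  have g2 : curveHom γ (X 2 - C (x : ℂ) * X 1) = κ τ * κ D1 * T ^ 2 := by
    simp [curveHom, hγ, κ]
  have g3 : curveHom γ (X 3 - C (y : ℂ) * X 1) = κ τ * κ D2 * T ^ 2 := by
    simp [curveHom, hγ, κ]
  have gC : ∀ r : ℝ, curveHom γ (C (r : ℂ)) = κ r := fun r => by simp [curveHom, κ]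
  have κadd : ∀ a b, κ (a + b) = κ a + κ b := fun a b => by simp [κ]
  have κsub : ∀ a b, κ (a - b) = κ a - κ b := fun a b => by simp [κ]
  have κmul : ∀ a b, κ (a * b) = κ a * κ b := fun a b => by simp [κ]
  have κpow : ∀ a (n : ℕ), κ (a ^ n) = κ a ^ n := fun a n => by simp [κ]
  have κ0 : κ 0 = 0 := by simp [κ]
  have κhalf : 2 * κ (1 / 2) = 1 := by
    rw [show (2 : Polynomial ℂ) = κ 2 from
      (congrArg Polynomial.C (Complex.ofReal_ofNat 2)).symm, ← κmul]
    norm_num [κ]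
  have line : ∀ s p : ℝ, (s - p) * (τ * (n2 * D1 - n1 * D2)) + s * p * (n1 ^ 2 + n2 ^ 2) = 0 →
      legForm !₂[x + s * n1, y + s * n2] !₂[x + p * n1, y + p * n2] ∈ curveIdeal γ 3 := by
    intro s p hsp
    have hk := congrArg κ hsp
    simp only [κadd, κsub, κmul, κpow, κ0] at hk
    rw [mem_curveIdeal, legForm_on_line]
    simp only [map_add, map_sub, map_mul, map_pow, g0, g1, g2, g3, gC, κadd, κsub, κmul, κpow]
    refine ⟨- (κ (1 / 2) * T * (κ s - κ p) * κ τ * (κ n2 * κ D1 - κ n1 * κ D2))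
      - (κ s + κ p) * (κ n1 * κ D1 + κ n2 * κ D2) * κ τ
      + T * ((κ τ * κ D1) ^ 2 + (κ τ * κ D2) ^ 2), ?_⟩
    change _ = T ^ 3 * _
    linear_combination T ^ 2 * hk
  refine three_le_multiplicity_of_curve Y (γ := γ) (z := X 1) ?_ X_one_mem ?_
    (constraintIdeal_le Y ?_ fun i => ?_)
  · intro i
    fin_cases i <;> simp [hγ, T]
  · rw [mem_curveIdeal, g1]
    exact not_X_sq_dvd_of_coeff_one (by simp [T])
  · rw [mem_curveIdeal, normForm]
    simp only [map_add, map_sub, map_pow, map_one, g0, g1]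
    refine ⟨κ (1 / 2) ^ 2 * T, ?_⟩
    change _ = T ^ 3 * _
    linear_combination - T ^ 2 * κhalf
  · obtain ⟨j, rfl⟩ := σ.surjective i
    fin_cases j
    · simp only [Fin.zero_eta, h.base0, h.platform0]
      exact line _ _ hτ1
    · simp only [Fin.mk_one, h.base1, h.platform1]
      exact line _ _ hτ2
    · simp only [Fin.reduceFinMk, h.base2, h.platform2]
      rw [mem_curveIdeal, legForm_through_platform]
      simp only [map_add, map_sub, map_mul, map_pow, g0, g1, g2, g3, gC]
      refine ⟨- (κ τ * (κ D1 ^ 2 + κ D2 ^ 2)) + T * ((κ τ * κ D1) ^ 2 + (κ τ * κ D2) ^ 2), ?_⟩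
      change _ = T ^ 3 * _
      ring

theorem three_le_multiplicity_iff (h : IsTwoLegsOnLine Y σ x y n1 n2 D1 D2 s1 s2 p1 p2)
    (h1 : s1 - p1 ≠ 0) (hD : n1 * D2 - n2 * D1 ≠ 0) :
    3 ≤ Y.multiplicity ↔ s1 * p1 * (s2 - p2) = s2 * p2 * (s1 - p1) :=
  ⟨h.eq_of_three_le_multiplicity h1 hD, h.three_le_multiplicity h1 hD⟩

end IsTwoLegsOnLine

/-! ### Collinear realisations are singular points -/

/-- The derivative in $q_0$ may stay unspecified, because the gradient of the normalisation,
$(2,0,0,0)$, clears it by a column operation. -/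
theorem eval_pderiv_constraint_succ (Y : Realisation) (i : Fin 3) :
    ∃ α : ℝ, ∀ k, MvPolynomial.eval ![(1 : ℝ), 0, 0, 0] (pderiv k (Y.constraint i.succ)) =
      ![α, 4 * Y.legMatrix i 0, 4 * Y.legMatrix i 1, 4 * Y.legMatrix i 2] k := by
  have h2 : ∀ k, pderiv k (2 : MvPolynomial (Fin 4) ℝ) = 0 := fun k =>
    (pderiv k).map_natCast 2
  refine ⟨MvPolynomial.eval ![(1 : ℝ), 0, 0, 0] (pderiv 0 (Y.constraint i.succ)), fun k => ?_⟩
  fin_cases k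
  · rfl
  all_goals
    rw [constraint_succ]
    simp [h2, legConstraint, legMatrix, pderiv_X, Derivation.leibniz, Derivation.leibniz_pow]
    try ring

theorem eval_pderiv_constraint_zero (Y : Realisation) (k : Fin 4) :
    MvPolynomial.eval ![(1 : ℝ), 0, 0, 0] (pderiv k (Y.constraint 0)) = ![2, 0, 0, 0] k := by
  fin_cases k <;>
  simp [constraint, pderiv_X, Derivation.leibniz_pow]

/-- The determinant of a `4 × 4` matrix whose last three columns are, at a point, multiples of one
vector modulo the first column, vanishes at this point to second order. -/
theorem det_vanishes_to_second_order {A : Type*} [CommRing A] [Algebra ℝ A] (ev : A →+* ℝ)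
    (D : Derivation ℝ A A) (N : Matrix (Fin 4) (Fin 4) A) (u : Fin 4 → ℝ) (κ ν : Fin 3 → ℝ)
    (h : ∀ k j, ev (N k (Fin.succ j)) = κ j * ev (N k 0) + ν j * u k) :
    ev N.det = 0 ∧ ev (D N.det) = 0 := by
  -- At the point the matrix has rank at most 2, so its $3\times3$ minors vanish there. The
  -- expansion makes both the value and the Leibniz derivative explicit polynomial identities.
  have hdet : N.det = N 0 0 * (N.submatrix (Fin.succAbove 0) Fin.succ).det
      - N 1 0 * (N.submatrix (Fin.succAbove 1) Fin.succ).det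
      + N 2 0 * (N.submatrix (Fin.succAbove 2) Fin.succ).det
      - N 3 0 * (N.submatrix (Fin.succAbove 3) Fin.succ).det := by
    rw [Matrix.det_succ_column_zero, Fin.sum_univ_four]
    simp
    ring
  have h0 : ∀ k, ev (N k 1) = κ 0 * ev (N k 0) + ν 0 * u k := fun k => h k 0
  have h1 : ∀ k, ev (N k 2) = κ 1 * ev (N k 0) + ν 1 * u k := fun k => h k 1
  have h2 : ∀ k, ev (N k 3) = κ 2 * ev (N k 0) + ν 2 * u k := fun k => h k 2
  have e0 : N.submatrix (Fin.succAbove 0) Fin.succ = Matrix.of ![![N 1 1, N 1 2, N 1 3],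
    ![N 2 1, N 2 2, N 2 3], ![N 3 1, N 3 2, N 3 3]] := by
    ext i j; fin_cases i <;> fin_cases j <;> rfl
  have e1 : N.submatrix (Fin.succAbove 1) Fin.succ = Matrix.of ![![N 0 1, N 0 2, N 0 3],
    ![N 2 1, N 2 2, N 2 3], ![N 3 1, N 3 2, N 3 3]] := by
    ext i j; fin_cases i <;> fin_cases j <;> rfl
  have e2 : N.submatrix (Fin.succAbove 2) Fin.succ = Matrix.of ![![N 0 1, N 0 2, N 0 3],
    ![N 1 1, N 1 2, N 1 3], ![N 3 1, N 3 2, N 3 3]] := by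
    ext i j; fin_cases i <;> fin_cases j <;> rfl
  have e3 : N.submatrix (Fin.succAbove 3) Fin.succ = Matrix.of ![![N 0 1, N 0 2, N 0 3],
    ![N 1 1, N 1 2, N 1 3], ![N 2 1, N 2 2, N 2 3]] := by
    ext i j; fin_cases i <;> fin_cases j <;> rfl
  rw [hdet, e0, e1, e2, e3]
  simp only [Matrix.det_fin_three, Matrix.of_apply, Matrix.cons_val]
  constructor
  · simp only [map_add, map_sub, map_mul, h0, h1, h2]
    ring
  · simp only [map_add, map_sub, map_mul, Derivation.leibniz, smul_eq_mul, h0, h1, h2]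
    ring

/-- All anchor points lie on the line through `(x, y)` with direction `(n1, n2)`. -/
theorem isSingularPoint_of_collinear (Y : Realisation) {x y n1 n2 : ℝ} {s p : Fin 3 → ℝ}
    (hb : ∀ i, Y.base i = !₂[x + s i * n1, y + s i * n2])
    (hp : ∀ i, Y.platform i = !₂[x + p i * n1, y + p i * n2]) : Y.IsSingularPoint := by
  choose α hα using eval_pderiv_constraint_succ Y
  -- The vector $(0, xn_2-yn_1, -n_2, n_1)$ holds the line coordinates of the common line; a leg
  -- contributes it in proportion to its signed length.
  have h : ∀ k j, MvPolynomial.eval ![(1 : ℝ), 0, 0, 0]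
      ((Matrix.of fun i j => pderiv i (Y.constraint j)) k (Fin.succ j)) =
      α j / 2 * MvPolynomial.eval ![(1 : ℝ), 0, 0, 0]
        ((Matrix.of fun i j => pderiv i (Y.constraint j)) k 0) +
      4 * (p j - s j) * ![0, x * n2 - y * n1, -n2, n1] k := by
    intro k j
    rw [Matrix.of_apply, Matrix.of_apply, hα, eval_pderiv_constraint_zero]
    fin_cases k <;> simp [legMatrix, hb, hp] <;> ring
  exact ⟨(det_vanishes_to_second_order _ (pderiv 0) _ _ _ _ h).1,
    fun i => (det_vanishes_to_second_order _ (pderiv i) _ _ _ _ h).2⟩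

end Realisation

/-! ### Isometries and similarities of the plane in coordinates -/

theorem norm_sq_plane (p : Plane) : ‖p‖ ^ 2 = p 0 ^ 2 + p 1 ^ 2 := by
  rw [EuclideanSpace.norm_sq_eq, Fin.sum_univ_two]
  simp

theorem plane_ext {p q : Plane} (h0 : p 0 = q 0) (h1 : p 1 = q 1) : p = q := by
  ext i
  fin_cases i
  exacts [h0, h1]

theorem det_plane (f : Plane →ₗ[ℝ] Plane) :
    LinearMap.det f = f !₂[1, 0] 0 * f !₂[0, 1] 1 - f !₂[0, 1] 0 * f !₂[1, 0] 1 := by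
  have h0 : (EuclideanSpace.basisFun (Fin 2) ℝ).toBasis 0 = !₂[(1 : ℝ), 0] := by
    apply plane_ext <;> simp
  have h1 : (EuclideanSpace.basisFun (Fin 2) ℝ).toBasis 1 = !₂[(0 : ℝ), 1] := by
    apply plane_ext <;> simp
  rw [← LinearMap.det_toMatrix (EuclideanSpace.basisFun (Fin 2) ℝ).toBasis, Matrix.det_fin_two]
  simp only [LinearMap.toMatrix_apply, h0, h1]
  simp

theorem isometry_coords (φ : Plane ≃ᵃⁱ[ℝ] Plane) :
    ∃ a b c d u v : ℝ, a ^ 2 + c ^ 2 = 1 ∧ b ^ 2 + d ^ 2 = 1 ∧ a * b + c * d = 0 ∧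
      LinearMap.det (φ.linearIsometryEquiv.toLinearEquiv : Plane →ₗ[ℝ] Plane) = a * d - b * c ∧
      ∀ p, φ p = !₂[u + a * p 0 + b * p 1, v + c * p 0 + d * p 1] := by
  set L := φ.linearIsometryEquiv with hL
  have hlin : ∀ p : Plane, L p = p 0 • L !₂[1, 0] + p 1 • L !₂[0, 1] := by
    intro p
    rw [← map_smul, ← map_smul, ← map_add]
    congr 1
    apply plane_ext <;> simp
  have hnorm : ∀ p : Plane, (L p 0) ^ 2 + (L p 1) ^ 2 = p 0 ^ 2 + p 1 ^ 2 := by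
    intro p
    rw [← norm_sq_plane, ← norm_sq_plane, L.norm_map]
  refine ⟨L !₂[1, 0] 0, L !₂[0, 1] 0, L !₂[1, 0] 1, L !₂[0, 1] 1, φ 0 0, φ 0 1, ?_, ?_, ?_, ?_, ?_⟩
  · simpa using hnorm !₂[1, 0]
  · simpa using hnorm !₂[0, 1]
  · have h0 := hnorm !₂[1, 0]
    have h1 := hnorm !₂[0, 1]
    have h2 := hnorm !₂[1, 1]
    rw [hlin !₂[1, 1]] at h2
    simp at h0 h1 h2
    linarith
  · rw [det_plane]
    rfl
  · intro p
    have h := φ.map_vadd 0 p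
    simp only [vadd_eq_add, add_zero] at h
    rw [h, ← hL, hlin]
    apply plane_ext <;> simp <;> ring

theorem exists_isometry {a b c d : ℝ} (h1 : a ^ 2 + c ^ 2 = 1) (h2 : b ^ 2 + d ^ 2 = 1)
    (h3 : a * b + c * d = 0) (u v : ℝ) : ∃ φ : Plane ≃ᵃⁱ[ℝ] Plane,
      LinearMap.det (φ.linearIsometryEquiv.toLinearEquiv : Plane →ₗ[ℝ] Plane) = a * d - b * c ∧
      ∀ p, φ p = !₂[u + a * p 0 + b * p 1, v + c * p 0 + d * p 1] := by
  let f : Plane →ₗ[ℝ] Plane :=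
    { toFun := fun p => !₂[a * p 0 + b * p 1, c * p 0 + d * p 1]
      map_add' := fun p q => by apply plane_ext <;> simp <;> ring
      map_smul' := fun r p => by apply plane_ext <;> simp <;> ring }
  have hf : ∀ p, f p = !₂[a * p 0 + b * p 1, c * p 0 + d * p 1] := fun _ => rfl
  let F : Plane →ₗᵢ[ℝ] Plane := ⟨f, fun p => by
    have : ‖f p‖ ^ 2 = ‖p‖ ^ 2 := by
      rw [norm_sq_plane, norm_sq_plane, hf]
      simp
      linear_combination p 0 ^ 2 * h1 + p 1 ^ 2 * h2 + 2 * p 0 * p 1 * h3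
    exact (sq_eq_sq₀ (norm_nonneg _) (norm_nonneg _)).1 this⟩
  let L : Plane ≃ₗᵢ[ℝ] Plane := F.toLinearIsometryEquiv rfl
  refine ⟨L.toAffineIsometryEquiv.trans (AffineIsometryEquiv.constVAdd ℝ Plane !₂[u, v]), ?_, ?_⟩
  · have : ((L.toAffineIsometryEquiv.trans
        (AffineIsometryEquiv.constVAdd ℝ Plane !₂[u, v])).linearIsometryEquiv.toLinearEquiv :
        Plane →ₗ[ℝ] Plane) = f := by
      ext p
      rfl
    rw [this, det_plane, hf, hf]
    simp
  · intro p
    change !₂[u, v] + f p = _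
    rw [hf]
    apply plane_ext <;> simp <;> ring

/-- The direct similarity with linear part `z ↦ (c + i s) z`, followed by a translation. -/
def similarity (c s u v : ℝ) (p : Plane) : Plane :=
  !₂[u + c * p 0 - s * p 1, v + s * p 0 + c * p 1]

theorem IsDirect.exists_eq_similarity {φ : Plane ≃ᵃⁱ[ℝ] Plane} (h : IsDirect φ) :
    ∃ c s u v : ℝ, c ^ 2 + s ^ 2 = 1 ∧ ∀ p, φ p = similarity c s u v p := by
  obtain ⟨a, b, c, d, u, v, h1, h2, h3, h4, h5⟩ := isometry_coords φ
  rw [IsDirect] at h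
  rw [h] at h4
  -- The sum of squares equals $2-2\det$.
  have e : (a - d) ^ 2 + (b + c) ^ 2 = 0 := by linear_combination h1 + h2 + 2 * h4
  have e1 : d = a := by nlinarith [sq_nonneg (a - d), sq_nonneg (b + c)]
  have e2 : b = -c := by nlinarith [sq_nonneg (a - d), sq_nonneg (b + c)]
  subst e1 e2
  refine ⟨d, c, u, v, h1, fun p => ?_⟩
  rw [h5, similarity]
  apply plane_ext <;> simp
  ring

theorem IsIndirect.exists_coords {φ : Plane ≃ᵃⁱ[ℝ] Plane} (h : IsIndirect φ) :
    ∃ c s u v : ℝ, c ^ 2 + s ^ 2 = 1 ∧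
      ∀ p, φ p = !₂[u + c * p 0 + s * p 1, v + s * p 0 - c * p 1] := by
  obtain ⟨a, b, c, d, u, v, h1, h2, h3, h4, h5⟩ := isometry_coords φ
  rw [IsIndirect] at h
  rw [h] at h4
  have e : (a + d) ^ 2 + (b - c) ^ 2 = 0 := by linear_combination h1 + h2 - 2 * h4
  have e1 : d = -a := by nlinarith [sq_nonneg (a + d), sq_nonneg (b - c)]
  have e2 : b = c := by nlinarith [sq_nonneg (a + d), sq_nonneg (b - c)]
  subst e1 e2
  refine ⟨a, b, u, v, h1, fun p => ?_⟩
  rw [h5]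
  apply plane_ext <;> simp
  ring

theorem exists_isDirect {c s : ℝ} (h : c ^ 2 + s ^ 2 = 1) (u v : ℝ) :
    ∃ φ : Plane ≃ᵃⁱ[ℝ] Plane, IsDirect φ ∧ ∀ p, φ p = similarity c s u v p := by
  obtain ⟨φ, h1, h2⟩ := exists_isometry (a := c) (b := -s) (c := s) (d := c) h
    (by linear_combination h) (by ring) u v
  refine ⟨φ, ?_, fun p => ?_⟩
  · rw [IsDirect, h1]
    linear_combination h
  · rw [h2, similarity]
    apply plane_ext <;> simp
    ring

theorem exists_isIndirect {c s : ℝ} (h : c ^ 2 + s ^ 2 = 1) (u v : ℝ) :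
    ∃ φ : Plane ≃ᵃⁱ[ℝ] Plane, IsIndirect φ ∧
      ∀ p, φ p = !₂[u + c * p 0 + s * p 1, v + s * p 0 - c * p 1] := by
  obtain ⟨φ, h1, h2⟩ := exists_isometry (a := c) (b := s) (c := s) (d := -c) h
    (by linear_combination h) (by ring) u v
  refine ⟨φ, ?_, fun p => ?_⟩
  · rw [IsIndirect, h1]
    linear_combination -h
  · rw [h2]
    apply plane_ext <;> simp
    ring

theorem similarity_injective {c s : ℝ} (h : c ^ 2 + s ^ 2 ≠ 0) (u v : ℝ) :
    Function.Injective (similarity c s u v) := by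
  intro p q hpq
  have h0 := congrArg (fun r : Plane => r 0) hpq
  have h1 := congrArg (fun r : Plane => r 1) hpq
  simp [similarity] at h0 h1
  apply plane_ext
  · apply mul_left_cancel₀ h
    linear_combination c * h0 + s * h1
  · apply mul_left_cancel₀ h
    linear_combination c * h1 - s * h0

/-- Twice the signed area of the triangle `p q r`. -/
def signedArea (p q r : Plane) : ℝ :=
  (q 0 - p 0) * (r 1 - p 1) - (r 0 - p 0) * (q 1 - p 1)

theorem collinear_range_iff (f : Fin 3 → Plane) :
    Collinear ℝ (Set.range f) ↔ signedArea (f 0) (f 1) (f 2) = 0 := by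
  constructor
  · intro h
    obtain ⟨p, v, hv⟩ := (collinear_iff_exists_forall_eq_smul_vadd _).1 h
    obtain ⟨r0, h0⟩ := hv (f 0) (Set.mem_range_self 0)
    obtain ⟨r1, h1⟩ := hv (f 1) (Set.mem_range_self 1)
    obtain ⟨r2, h2⟩ := hv (f 2) (Set.mem_range_self 2)
    rw [h0, h1, h2, signedArea]
    simp
    ring
  · intro h
    rw [signedArea] at h
    by_cases h01 : f 1 = f 0
    · rw [collinear_iff_of_mem (p₀ := f 0) (Set.mem_range_self 0)]
      refine ⟨f 2 - f 0, ?_⟩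
      rintro _ ⟨i, rfl⟩
      fin_cases i
      · exact ⟨0, by simp⟩
      · exact ⟨0, by simp [h01]⟩
      · exact ⟨1, by simp⟩
    · rw [collinear_iff_of_mem (p₀ := f 0) (Set.mem_range_self 0)]
      refine ⟨f 1 - f 0, ?_⟩
      rintro _ ⟨i, rfl⟩
      fin_cases i
      · exact ⟨0, by simp⟩
      · exact ⟨1, by simp⟩
      · have hn : (f 1 0 - f 0 0) ^ 2 + (f 1 1 - f 0 1) ^ 2 ≠ 0 := by
          intro h2
          apply h01
          apply plane_ext
          · nlinarith [sq_nonneg (f 1 0 - f 0 0), sq_nonneg (f 1 1 - f 0 1)]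
          · nlinarith [sq_nonneg (f 1 0 - f 0 0), sq_nonneg (f 1 1 - f 0 1)]
        -- This is the coefficient of the orthogonal projection onto the direction from `f 0` to `f
        -- 1`.
        refine ⟨((f 2 0 - f 0 0) * (f 1 0 - f 0 0) + (f 2 1 - f 0 1) * (f 1 1 - f 0 1)) /
          ((f 1 0 - f 0 0) ^ 2 + (f 1 1 - f 0 1) ^ 2), ?_⟩
        apply plane_ext
        · simp
          field_simp
          linear_combination -(f 1 1 - f 0 1) * h
        · simp
          field_simp
          linear_combination (f 1 0 - f 0 0) * h

theorem collinear_of_forall_similarity {ι : Type*} {f : ι → Plane} {c s u v : ℝ}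
    (h : ∀ i, ∃ r : ℝ, f i = similarity c s u v !₂[r, 0]) : Collinear ℝ (Set.range f) := by
  rw [collinear_iff_exists_forall_eq_smul_vadd]
  refine ⟨!₂[u, v], !₂[c, s], ?_⟩
  rintro _ ⟨i, rfl⟩
  obtain ⟨r, hr⟩ := h i
  refine ⟨r, ?_⟩
  rw [hr, similarity]
  apply plane_ext <;> simp <;> ring

namespace Realisation

/-- A similarity of ratio $r$ acts linearly on line coordinates with determinant $r^4$, and
relabelling only changes a sign. -/
theorem det_legMatrix_eq_zero_iff_of_similarity {Y W : Realisation} {σ : Equiv.Perm (Fin 3)}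
    {c s u v : ℝ} (h : c ^ 2 + s ^ 2 ≠ 0)
    (hb : ∀ i, Y.base (σ i) = similarity c s u v (W.base i))
    (hp : ∀ i, Y.platform (σ i) = similarity c s u v (W.platform i)) :
    Y.legMatrix.det = 0 ↔ W.legMatrix.det = 0 := by
  have h1 : (Y.legMatrix.submatrix σ id).det = (c ^ 2 + s ^ 2) ^ 2 * W.legMatrix.det := by
    rw [Matrix.det_fin_three, Matrix.det_fin_three]
    simp only [Matrix.submatrix_apply, id, legMatrix, Matrix.of_apply, Matrix.cons_val, hb, hp,
      similarity]
    ring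
  rw [Matrix.det_permute] at h1
  have h2 : ((Equiv.Perm.sign σ : ℤ) : ℝ) ≠ 0 := by exact_mod_cast (Equiv.Perm.sign σ).ne_zero
  constructor
  · intro h0
    rw [h0, mul_zero] at h1
    exact (mul_eq_zero.1 h1.symm).resolve_left (pow_ne_zero 2 h)
  · intro h0
    rw [h0, mul_zero] at h1
    exact (mul_eq_zero.1 h1).resolve_left h2

/-! ### The averaged configuration in an adapted frame -/

/-- The averaged configuration of a glide pair, up to a direct similarity. -/
def normalForm (d f0 f1 : ℝ) (base platform : Fin 3 → Plane) : Realisation where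
  base i := !₂[f0 * base i 0, f0 * base i 1]
  platform i := !₂[f0 * platform i 0 - f1 * platform i 1 + d * f0 / 2, -(d * f1 / 2)]

theorem midpoint_zero (x y : Plane) : midpoint ℝ x y 0 = (x 0 + y 0) / 2 := by
  rw [midpoint_eq_smul_add]
  simp
  ring

theorem midpoint_one (x y : Plane) : midpoint ℝ x y 1 = (x 1 + y 1) / 2 := by
  rw [midpoint_eq_smul_add]
  simp
  ring

/-- The opposite translations cancel in the mean. Undoing the rotation $c+is$ and the scale $k$
leaves multiplication by $(c-is)(f_0+if_1)$, up to scale, and a translation. -/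
theorem midpoint_eq_similarity {c s u v k f0 f1 ki Ni : ℝ} {t x x' y y' w : Plane}
    (hcs : c ^ 2 + s ^ 2 = 1) (hk : k * ki = 1)
    (h : k • similarity c s u v x + t = y) (h' : k • similarity c s u v x' - t = y')
    (h0 : y 0 + y' 0 = 2 * Ni * (f0 * w 0 - f1 * w 1))
    (h1 : y 1 + y' 1 = 2 * Ni * (f1 * w 0 + f0 * w 1)) :
    midpoint ℝ x x' = similarity ((c * f0 + s * f1) * ki * Ni) ((c * f1 - s * f0) * ki * Ni)
      (-(c * u + s * v)) (-(c * v - s * u)) w := by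
  rw [← h, ← h'] at h0 h1
  simp [similarity] at h0 h1
  have e0 : 2 * u + c * (x 0 + x' 0) - s * (x 1 + x' 1) =
      2 * ki * Ni * (f0 * w 0 - f1 * w 1) := by
    linear_combination ki * h0 - (2 * u + c * (x 0 + x' 0) - s * (x 1 + x' 1)) * hk
  have e1 : 2 * v + s * (x 0 + x' 0) + c * (x 1 + x' 1) =
      2 * ki * Ni * (f1 * w 0 + f0 * w 1) := by
    linear_combination ki * h1 - (2 * v + s * (x 0 + x' 0) + c * (x 1 + x' 1)) * hk
  apply plane_ext
  · rw [midpoint_zero]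
    simp [similarity]
    linear_combination c / 2 * e0 + s / 2 * e1 - (x 0 + x' 0) / 2 * hcs
  · rw [midpoint_one]
    simp [similarity]
    linear_combination c / 2 * e1 - s / 2 * e0 - (x 1 + x' 1) / 2 * hcs

/-- Writing $f=f_0+if_1$ and $N=|f|^2$, the rotation is $f^2/N$. Hence the mean of $z$ and its
rotation is $(f/N)f_0z$, and that of the rotated and the glide-reflected point is
$(f/N)(\mathrm{Re}(fz)+d\bar f/2)$. The common factor $f/N$ goes into the similarity. -/
theorem TakesForm.exists_similarity {X X' : Realisation} {d f0 f1 : ℝ}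
    {base platform : Fin 3 → Plane} (hf : f0 ≠ 0 ∨ f1 ≠ 0)
    (h : X.TakesForm X' (glidePair d f0 f1 base platform)) :
    ∃ (σ : Equiv.Perm (Fin 3)) (c s u v : ℝ), c ^ 2 + s ^ 2 ≠ 0 ∧
      (∀ i, (X.averaged X').base (σ i) =
        similarity c s u v ((normalForm d f0 f1 base platform).base i)) ∧
      ∀ i, (X.averaged X').platform (σ i) =
        similarity c s u v ((normalForm d f0 f1 base platform).platform i) := by
  obtain ⟨σ, g, k, t, hg, hk, hb, hp, hb', hp'⟩ := h
  obtain ⟨c, s, u, v, hcs, hgs⟩ := hg.exists_eq_similarity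
  simp only [hgs] at hb hp hb' hp'
  have hN : f0 ^ 2 + f1 ^ 2 ≠ 0 := by
    rcases hf with hf | hf <;> positivity
  have hNi : (f0 ^ 2 + f1 ^ 2) * (f0 ^ 2 + f1 ^ 2)⁻¹ = 1 := mul_inv_cancel₀ hN
  have hki : k * k⁻¹ = 1 := mul_inv_cancel₀ hk.ne'
  refine ⟨σ, (c * f0 + s * f1) * k⁻¹ * (f0 ^ 2 + f1 ^ 2)⁻¹,
    (c * f1 - s * f0) * k⁻¹ * (f0 ^ 2 + f1 ^ 2)⁻¹, -(c * u + s * v), -(c * v - s * u),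
    ?_, fun i => ?_, fun i => ?_⟩
  · have : ((c * f0 + s * f1) * k⁻¹ * (f0 ^ 2 + f1 ^ 2)⁻¹) ^ 2 +
        ((c * f1 - s * f0) * k⁻¹ * (f0 ^ 2 + f1 ^ 2)⁻¹) ^ 2 =
        (k⁻¹) ^ 2 * (f0 ^ 2 + f1 ^ 2)⁻¹ := by
      linear_combination (k⁻¹) ^ 2 * ((f0 ^ 2 + f1 ^ 2)⁻¹) ^ 2 * (f0 ^ 2 + f1 ^ 2) * hcs
        + (k⁻¹) ^ 2 * (f0 ^ 2 + f1 ^ 2)⁻¹ * hNi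
    rw [this]
    exact mul_ne_zero (pow_ne_zero 2 (inv_ne_zero hk.ne')) (inv_ne_zero hN)
  · refine midpoint_eq_similarity hcs hki (hb i) (hb' i) ?_ ?_
    · simp [glidePair, bgTransform, normalForm, div_eq_mul_inv]
      linear_combination (-(base i 0)) * hNi
    · simp [glidePair, bgTransform, normalForm, div_eq_mul_inv]
      linear_combination (-(base i 1)) * hNi
  · refine midpoint_eq_similarity hcs hki (hp i) (hp' i) ?_ ?_
    · simp [glidePair, bgTransform, normalForm, glide, div_eq_mul_inv]
      linear_combination (-(platform i 0) - d) * hNi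
    · simp [glidePair, bgTransform, normalForm, glide, div_eq_mul_inv]
      linear_combination (platform i 1) * hNi

theorem signedArea_bgTransform {f0 f1 : ℝ} (hf : f0 ≠ 0 ∨ f1 ≠ 0) (p q r : Plane) :
    signedArea (bgTransform f0 f1 0 0 p) (bgTransform f0 f1 0 0 q) (bgTransform f0 f1 0 0 r) =
      signedArea p q r := by
  have hN : f0 ^ 2 + f1 ^ 2 ≠ 0 := by
    rcases hf with hf | hf <;> positivity
  simp [signedArea, bgTransform]
  field_simp
  ring

theorem TakesForm.signedArea_ne_zero {X X' : Realisation} {d f0 f1 : ℝ}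
    {base platform : Fin 3 → Plane} (hf : f0 ≠ 0 ∨ f1 ≠ 0)
    (h : X.TakesForm X' (glidePair d f0 f1 base platform))
    (hX : ¬ Collinear ℝ (Set.range X.platform)) :
    signedArea (platform 0) (platform 1) (platform 2) ≠ 0 := by
  obtain ⟨σ, g, k, t, hg, hk, hb, hp, hb', hp'⟩ := h
  obtain ⟨c, s, u, v, hcs, hgs⟩ := hg.exists_eq_similarity
  simp only [hgs, glidePair] at hp
  rw [← signedArea_bgTransform hf, ← hp, ← hp, ← hp]
  intro h0
  apply hX
  have : Set.range X.platform = Set.range (X.platform ∘ σ) := (σ.surjective.range_comp _).symm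
  rw [this, collinear_range_iff]
  have h1 : k ^ 2 * (c ^ 2 + s ^ 2) * signedArea (X.platform (σ 0)) (X.platform (σ 1))
      (X.platform (σ 2)) = 0 := by
    rw [← h0]
    simp [signedArea, similarity]
    ring
  rw [hcs, mul_one] at h1
  exact (mul_eq_zero.1 h1).resolve_left (pow_ne_zero 2 hk.ne')

/-- Direct similarities carry the leg conditions over to the normal form. -/
theorem HasStructure.leg_ne_of_similarity {Y W : Realisation} (hY : Y.HasStructure)
    {σ : Equiv.Perm (Fin 3)} {c s u v : ℝ}
    (hb : ∀ i, Y.base (σ i) = similarity c s u v (W.base i))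
    (hp : ∀ i, Y.platform (σ i) = similarity c s u v (W.platform i)) (i : Fin 3) :
    W.base i ≠ W.platform i := by
  intro h
  apply hY.leg_ne (σ i)
  rw [hb, hp, h]

theorem isSingularPoint_of_similarity {Y : Realisation} {c s u v : ℝ}
    (hb : ∀ i, ∃ r : ℝ, Y.base i = similarity c s u v !₂[r, 0])
    (hp : ∀ i, ∃ r : ℝ, Y.platform i = similarity c s u v !₂[r, 0]) : Y.IsSingularPoint := by
  choose B hB using hb
  choose P hP using hp
  refine isSingularPoint_of_collinear Y (x := u) (y := v) (n1 := c) (n2 := s) (s := B) (p := P)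
    (fun i => ?_) (fun i => ?_)
  · rw [hB, similarity]
    apply plane_ext <;> simp <;> ring
  · rw [hP, similarity]
    apply plane_ext <;> simp <;> ring

/-! ### The glide-reflection case -/

/-- The vector of leg $i$ is $(f_1+2f_0l_i)(b_{i+3}, d/2)$, whence the three factors; each vanishes
only for a leg of length zero. The area is that of the original platform. -/
theorem det_normalForm_pairI (d f0 f1 a5 b5 a6 b6 l1 l2 l3 : ℝ) :
    (normalForm d f0 f1
      ![bisectorPoint !₂[0, 1] (glide d !₂[0, 1]) l1,
        bisectorPoint !₂[a5, b5] (glide d !₂[a5, b5]) l2,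
        bisectorPoint !₂[a6, b6] (glide d !₂[a6, b6]) l3]
      ![!₂[0, 1], !₂[a5, b5], !₂[a6, b6]]).legMatrix.det =
    -(f0 * d ^ 2) * (f1 + 2 * f0 * l1) * (f1 + 2 * f0 * l2) * (f1 + 2 * f0 * l3) / 4 *
      signedArea !₂[0, 1] !₂[a5, b5] !₂[a6, b6] := by
  rw [Matrix.det_fin_three]
  simp [legMatrix, normalForm, bisectorPoint, glide, signedArea]
  ring

theorem IsCaseI.one_le_flexionOrder_iff {X X' : Realisation}
    {d f0 f1 a5 b5 a6 b6 l1 l2 l3 : ℝ} (hX : ¬ Collinear ℝ (Set.range X.platform))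
    (hA : (X.averaged X').HasStructure) (h : X.IsCaseI X' d f0 f1 a5 b5 a6 b6 l1 l2 l3) :
    1 ≤ (X.averaged X').flexionOrder ↔ f0 = 0 := by
  obtain ⟨hf, hd, hT⟩ := h
  have harea := hT.signedArea_ne_zero hf hX
  obtain ⟨σ, c, s, u, v, hcs, hb, hp⟩ := hT.exists_similarity hf
  have hleg := hA.leg_ne_of_similarity hb hp
  rw [Realisation.one_le_flexionOrder_iff, det_legMatrix_eq_zero_iff_of_similarity hcs hb hp,
    det_normalForm_pairI]
  have h1 : f1 + 2 * f0 * l1 ≠ 0 := by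
    intro h0
    apply hleg 0
    apply plane_ext
    · simp [normalForm, bisectorPoint, glide]
      linear_combination h0
    · simp [normalForm, bisectorPoint, glide]
      linear_combination d / 2 * h0
  have h2 : f1 + 2 * f0 * l2 ≠ 0 := by
    intro h0
    apply hleg 1
    apply plane_ext
    · simp [normalForm, bisectorPoint, glide]
      linear_combination b5 * h0
    · simp [normalForm, bisectorPoint, glide]
      linear_combination d / 2 * h0
  have h3 : f1 + 2 * f0 * l3 ≠ 0 := by
    intro h0
    apply hleg 2
    apply plane_ext
    · simp [normalForm, bisectorPoint, glide]
      linear_combination b6 * h0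
    · simp [normalForm, bisectorPoint, glide]
      linear_combination d / 2 * h0
  have harea' : signedArea !₂[0, 1] !₂[a5, b5] !₂[a6, b6] ≠ 0 := harea
  simp [hd, h1, h2, h3, harea']

/-! ### Reflection with two platform points on the axis -/

/-- Leg 1 lies on the axis, and legs 2 and 3 meet it in their platform points. If these differ,
concurrence forces leg 2 or leg 3 into the axis. -/
theorem det_normalForm_pairIIiii (f0 f1 a2 b2 a3 b3 a5 a6 l1 : ℝ) :
    (normalForm 0 f0 f1
      ![bisectorPoint !₂[0, 1] (glide 0 !₂[0, 1]) l1, !₂[a2, b2], !₂[a3, b3]]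
      ![!₂[0, 1], !₂[a5, 0], !₂[a6, 0]]).legMatrix.det =
    f0 * b2 * b3 * (-f0 ^ 2 * (f1 + 2 * f0 * l1) *
      signedArea !₂[0, 1] !₂[a5, 0] !₂[a6, 0]) := by
  rw [Matrix.det_fin_three]
  simp [legMatrix, normalForm, bisectorPoint, glide, signedArea]
  ring

theorem IsCaseIIiii.one_le_flexionOrder_iff {X X' : Realisation}
    {f0 f1 a2 b2 a3 b3 a5 a6 l1 : ℝ} (hX : ¬ Collinear ℝ (Set.range X.platform))
    (hA : (X.averaged X').HasStructure) (h : X.IsCaseIIiii X' f0 f1 a2 b2 a3 b3 a5 a6 l1) :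
    1 ≤ (X.averaged X').flexionOrder ↔ f0 * b2 * b3 = 0 := by
  obtain ⟨hf, hT⟩ := h
  have harea := hT.signedArea_ne_zero hf hX
  obtain ⟨σ, c, s, u, v, hcs, hb, hp⟩ := hT.exists_similarity hf
  have hleg := hA.leg_ne_of_similarity hb hp
  rw [Realisation.one_le_flexionOrder_iff, det_legMatrix_eq_zero_iff_of_similarity hcs hb hp,
    det_normalForm_pairIIiii]
  have h1 : f1 + 2 * f0 * l1 ≠ 0 := by
    intro h0
    apply hleg 0
    apply plane_ext
    · simp [normalForm, bisectorPoint, glide]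
      linear_combination h0
    · simp [normalForm, bisectorPoint, glide]
  have harea' : signedArea !₂[0, 1] !₂[a5, 0] !₂[a6, 0] ≠ 0 := harea
  constructor
  · intro h0
    by_contra hne
    have hf0 : f0 ≠ 0 := fun h => hne (by rw [h]; ring)
    exact mul_ne_zero hne (mul_ne_zero (mul_ne_zero (neg_ne_zero.2 (pow_ne_zero 2 hf0)) h1) harea') h0
  · intro h0
    rw [h0, zero_mul]

/-! ### The reflection cases with collinear legs -/

theorem IsCaseIIi.conclusion {X X' : Realisation} {f0 f1 a5 b5 a6 b6 l1 l2 l3 : ℝ}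
    (h : X.IsCaseIIi X' f0 f1 a5 b5 a6 b6 l1 l2 l3) :
    1 ≤ (X.averaged X').flexionOrder ∧
      Collinear ℝ (Set.range (X.averaged X').base ∪ Set.range (X.averaged X').platform) ∧
      (X.averaged X').IsSingularPoint := by
  obtain ⟨hf, -, -, hT⟩ := h
  obtain ⟨σ, c, s, u, v, hcs, hb, hp⟩ := hT.exists_similarity hf
  have hb' : ∀ i, ∃ r : ℝ, (X.averaged X').base i = similarity c s u v !₂[r, 0] := by
    intro i
    obtain ⟨j, rfl⟩ := σ.surjective i
    -- The abscissa is found by unification; only the vanishing ordinate, i.e. lying on the axis,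
    -- needs proof.
    refine ⟨_, (hb j).trans (congrArg _ (plane_ext (p := _) (q := !₂[_, 0]) rfl ?_))⟩
    fin_cases j <;> simp [normalForm, bisectorPoint, glide]
  have hp' : ∀ i, ∃ r : ℝ, (X.averaged X').platform i = similarity c s u v !₂[r, 0] := by
    intro i
    obtain ⟨j, rfl⟩ := σ.surjective i
    refine ⟨_, (hp j).trans (congrArg _ (plane_ext (p := _) (q := !₂[_, 0]) rfl ?_))⟩
    simp [normalForm]
  refine ⟨?_, ?_, isSingularPoint_of_similarity hb' hp'⟩
  · rw [Realisation.one_le_flexionOrder_iff, det_legMatrix_eq_zero_iff_of_similarity hcs hb hp,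
      det_normalForm_pairI]
    ring
  · rw [← Set.Sum.elim_range]
    apply collinear_of_forall_similarity (c := c) (s := s) (u := u) (v := v)
    rintro (i | i)
    exacts [hb' i, hp' i]

theorem IsCaseIIii.conclusion {X X' : Realisation} {f0 f1 a3 b3 a5 b5 a6 l1 l2 : ℝ}
    (hA : (X.averaged X').HasStructure) (h : X.IsCaseIIii X' f0 f1 a3 b3 a5 b5 a6 l1 l2) :
    1 ≤ (X.averaged X').flexionOrder ∧
      (¬ (X.averaged X').IsSingularPoint →
        (2 ≤ (X.averaged X').flexionOrder ↔ polyIIii f0 f1 a5 b5 a6 l1 l2 = 0)) := by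
  obtain ⟨hf, -, hT⟩ := h
  obtain ⟨σ, c, s, u, v, hcs, hb, hp⟩ := hT.exists_similarity hf
  have hleg := hA.leg_ne_of_similarity hb hp
  constructor
  · rw [Realisation.one_le_flexionOrder_iff, det_legMatrix_eq_zero_iff_of_similarity hcs hb hp,
      Matrix.det_fin_three]
    simp [legMatrix, normalForm, bisectorPoint, glide]
  · intro hsing
    -- The third base point is the only one that can leave the axis; if it does not, the
    -- configuration is collinear and hence singular.
    have hfb : f0 * b3 ≠ 0 := by
      intro h0
      apply hsing
      refine isSingularPoint_of_similarity (c := c) (s := s) (u := u) (v := v)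
        (fun i => ?_) (fun i => ?_)
      · obtain ⟨j, rfl⟩ := σ.surjective i
        refine ⟨_, (hb j).trans (congrArg _ (plane_ext (p := _) (q := !₂[_, 0]) rfl ?_))⟩
        fin_cases j
        · simp [normalForm, bisectorPoint, glide]
        · simp [normalForm, bisectorPoint, glide]
        · simpa [normalForm] using h0
      · obtain ⟨j, rfl⟩ := σ.surjective i
        refine ⟨_, (hp j).trans (congrArg _ (plane_ext (p := _) (q := !₂[_, 0]) rfl ?_))⟩
        simp [normalForm]
    have h1 : f1 + 2 * f0 * l1 ≠ 0 := by
      intro h0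
      apply hleg 0
      apply plane_ext
      · simp [normalForm, bisectorPoint, glide]
        linear_combination h0
      · simp [normalForm, bisectorPoint, glide]
    -- The centre is the image of the third platform point $(f_0a_6,0)$; the other abscissae are
    -- measured from it.
    have hline : IsTwoLegsOnLine (X.averaged X') σ (u + c * (f0 * a6)) (v + s * (f0 * a6)) c s
        (c * (f0 * a3 - f0 * a6) - s * (f0 * b3)) (s * (f0 * a3 - f0 * a6) + c * (f0 * b3))
        (2 * f0 * l1 - f0 * a6) (f0 * (a5 + 2 * l2 * b5) - f0 * a6)
        (-f1 - f0 * a6) (f0 * a5 - f1 * b5 - f0 * a6) := by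
      constructor
      · rw [hb 0]
        apply plane_ext <;> simp [normalForm, bisectorPoint, glide, similarity] <;> ring
      · rw [hb 1]
        apply plane_ext <;> simp [normalForm, bisectorPoint, glide, similarity] <;> ring
      · rw [hb 2]
        apply plane_ext <;> simp [normalForm, similarity] <;> ring
      · rw [hp 0]
        apply plane_ext <;> simp [normalForm, similarity] <;> ring
      · rw [hp 1]
        apply plane_ext <;> simp [normalForm, similarity] <;> ring
      · rw [hp 2]
        apply plane_ext <;> simp [normalForm, similarity]
    have hlen : 2 * f0 * l1 - f0 * a6 - (-f1 - f0 * a6) ≠ 0 := by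
      intro h0
      apply h1
      linear_combination h0
    have hdir : c * (s * (f0 * a3 - f0 * a6) + c * (f0 * b3)) -
        s * (c * (f0 * a3 - f0 * a6) - s * (f0 * b3)) ≠ 0 := by
      rw [show c * (s * (f0 * a3 - f0 * a6) + c * (f0 * b3)) -
        s * (c * (f0 * a3 - f0 * a6) - s * (f0 * b3)) = (c ^ 2 + s ^ 2) * (f0 * b3) by ring]
      exact mul_ne_zero hcs hfb
    rw [two_le_flexionOrder_iff, hline.three_le_multiplicity_iff hlen hdir, ← sub_eq_zero]
    have hP : (2 * f0 * l1 - f0 * a6) * (-f1 - f0 * a6) *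
          (f0 * (a5 + 2 * l2 * b5) - f0 * a6 - (f0 * a5 - f1 * b5 - f0 * a6)) -
        (f0 * (a5 + 2 * l2 * b5) - f0 * a6) * (f0 * a5 - f1 * b5 - f0 * a6) *
          (2 * f0 * l1 - f0 * a6 - (-f1 - f0 * a6)) =
        -f0 * polyIIii f0 f1 a5 b5 a6 l1 l2 := by
      rw [polyIIii]
      ring
    rw [hP, mul_eq_zero, neg_eq_zero]
    exact or_iff_right (left_ne_zero_of_mul hfb)

/-! ### Glide pairs are pairs of Set C -/

theorem exists_isDirect_eq_bgTransform {f0 f1 : ℝ} (hf : f0 ≠ 0 ∨ f1 ≠ 0) :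
    ∃ φ : Plane ≃ᵃⁱ[ℝ] Plane, IsDirect φ ∧ ∀ p, φ p = bgTransform f0 f1 0 0 p := by
  have hN : f0 ^ 2 + f1 ^ 2 ≠ 0 := by
    rcases hf with hf | hf <;> positivity
  obtain ⟨φ, h1, h2⟩ := exists_isDirect (c := (f0 ^ 2 - f1 ^ 2) / (f0 ^ 2 + f1 ^ 2))
    (s := 2 * f0 * f1 / (f0 ^ 2 + f1 ^ 2)) (by field_simp; ring) 0 0
  refine ⟨φ, h1, fun p => ?_⟩
  rw [h2]
  apply plane_ext <;> simp [similarity, bgTransform] <;> ring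

theorem dist_bgTransform {f0 f1 : ℝ} (hf : f0 ≠ 0 ∨ f1 ≠ 0) (p q : Plane) :
    dist (bgTransform f0 f1 0 0 p) (bgTransform f0 f1 0 0 q) = dist p q := by
  obtain ⟨φ, -, h⟩ := exists_isDirect_eq_bgTransform hf
  rw [← h, ← h, φ.dist_map]

theorem bgTransform_injective {f0 f1 : ℝ} (hf : f0 ≠ 0 ∨ f1 ≠ 0) :
    Function.Injective (bgTransform f0 f1 0 0) := by
  obtain ⟨φ, -, h⟩ := exists_isDirect_eq_bgTransform hf
  rw [← funext h]
  exact φ.injective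

theorem glide_injective (d : ℝ) : Function.Injective (glide d) := by
  intro p q h
  have h0 := congrArg (fun r : Plane => r 0) h
  have h1 := congrArg (fun r : Plane => r 1) h
  simp [glide] at h0 h1
  exact plane_ext h0 h1

theorem injective_of_signedArea_ne_zero {p : Fin 3 → Plane}
    (h : signedArea (p 0) (p 1) (p 2) ≠ 0) : Function.Injective p := by
  have hc : ¬ Collinear ℝ (Set.range p) := fun hc => h ((collinear_range_iff p).1 hc)
  exact (affineIndependent_iff_not_collinear.2 hc).injective

/-- The direct isometry is the inverse rotation, and the indirect one is this rotation followed by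
the glide-reflection. -/
theorem glidePair_isSetC {d f0 f1 : ℝ} {b p : Fin 3 → Plane} (hf : f0 ≠ 0 ∨ f1 ≠ 0)
    (hleg : ∀ i, b i ≠ p i) (hdist : ∀ i, dist (b i) (p i) = dist (b i) (glide d (p i)))
    (hb : ∃ i j, b i ≠ b j) (hp : signedArea (p 0) (p 1) (p 2) ≠ 0) :
    (glidePair d f0 f1 b p).1.IsSetC (glidePair d f0 f1 b p).2 := by
  have hN : f0 ^ 2 + f1 ^ 2 ≠ 0 := by
    rcases hf with hf | hf <;> positivity
  have hcs : ((f0 ^ 2 - f1 ^ 2) / (f0 ^ 2 + f1 ^ 2)) ^ 2 +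
      (2 * f0 * f1 / (f0 ^ 2 + f1 ^ 2)) ^ 2 = 1 := by
    field_simp
    ring
  have hinj := injective_of_signedArea_ne_zero hp
  have hR := bgTransform_injective hf
  obtain ⟨i, j, hij⟩ := hb
  refine ⟨⟨⟨fun i => hR.ne (hleg i), fun i j hij => Or.inr (hR.ne (hinj.ne hij))⟩,
      ⟨i, j, hR.ne hij⟩, ⟨0, 1, hR.ne (hinj.ne (by decide))⟩⟩,
    ⟨⟨fun i => ?_, fun i j hij => Or.inr ((glide_injective d).ne (hinj.ne hij))⟩,
      ⟨i, j, hij⟩, ⟨0, 1, (glide_injective d).ne (hinj.ne (by decide))⟩⟩, fun i => ?_, ?_, ?_, ?_⟩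
  · have h := dist_pos.2 (hleg i)
    rw [hdist] at h
    exact dist_pos.1 h
  · change dist (bgTransform f0 f1 0 0 (b i)) (bgTransform f0 f1 0 0 (p i)) =
      dist (b i) (glide d (p i))
    rw [dist_bgTransform hf, hdist]
  · obtain ⟨φ, h1, h2⟩ := exists_isDirect (c := (f0 ^ 2 - f1 ^ 2) / (f0 ^ 2 + f1 ^ 2))
      (s := -(2 * f0 * f1 / (f0 ^ 2 + f1 ^ 2))) (by rw [neg_sq]; exact hcs) 0 0
    refine ⟨φ, h1, fun i => ?_⟩
    rw [h2]
    apply plane_ext <;> simp [glidePair, similarity, bgTransform] <;> field_simp <;> ring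
  · obtain ⟨φ, h1, h2⟩ := exists_isIndirect hcs d 0
    refine ⟨φ, h1, fun i => ?_⟩
    rw [h2]
    apply plane_ext <;> simp [glidePair, glide, bgTransform] <;> field_simp <;> ring
  · rw [collinear_range_iff]
    change ¬ signedArea (bgTransform f0 f1 0 0 (p 0)) (bgTransform f0 f1 0 0 (p 1))
      (bgTransform f0 f1 0 0 (p 2)) = 0
    rwa [signedArea_bgTransform hf]

theorem takesForm_self (Z : Realisation × Realisation) : Z.1.TakesForm Z.2 Z := by
  refine ⟨1, AffineIsometryEquiv.refl ℝ Plane, 1, 0, ?_, one_pos, ?_, ?_, ?_, ?_⟩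
  · rw [IsDirect, det_plane]
    simp [AffineIsometryEquiv.linearIsometryEquiv]
  all_goals simp

theorem HasStructure.of_similarity {Y W : Realisation} (hW : W.HasStructure)
    {σ : Equiv.Perm (Fin 3)} {c s u v : ℝ} (h : c ^ 2 + s ^ 2 ≠ 0)
    (hb : ∀ i, Y.base (σ i) = similarity c s u v (W.base i))
    (hp : ∀ i, Y.platform (σ i) = similarity c s u v (W.platform i)) : Y.HasStructure := by
  have hinj := similarity_injective h u v
  constructor
  · intro i
    obtain ⟨i, rfl⟩ := σ.surjective i
    rw [hb, hp]
    exact hinj.ne (hW.leg_ne i)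
  · intro i j hij
    obtain ⟨i, rfl⟩ := σ.surjective i
    obtain ⟨j, rfl⟩ := σ.surjective j
    rw [hb, hp, hb, hp]
    exact (hW.legs_distinct i j fun h => hij (congrArg σ h)).imp hinj.ne hinj.ne

theorem averaged_glidePair_hasStructure {d f0 f1 : ℝ} {b p : Fin 3 → Plane}
    (hf : f0 ≠ 0 ∨ f1 ≠ 0) (hW : (normalForm d f0 f1 b p).HasStructure) :
    ((glidePair d f0 f1 b p).1.averaged (glidePair d f0 f1 b p).2).HasStructure := by
  obtain ⟨σ, c, s, u, v, hcs, hb, hp⟩ := (takesForm_self (glidePair d f0 f1 b p)).exists_similarity hf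
  exact hW.of_similarity hcs hb hp

/-- In a congruent glide pair every base point is equidistant from every platform point and its
image under the glide-reflection. -/
theorem glidePair_equidistant {d f0 f1 : ℝ} {b p : Fin 3 → Plane} (hf : f0 ≠ 0 ∨ f1 ≠ 0)
    (h : ¬ (glidePair d f0 f1 b p).1.Incongruent (glidePair d f0 f1 b p).2) (i j : Fin 3) :
    d ^ 2 - 2 * d * (b i 0 - p j 0) + 4 * b i 1 * p j 1 = 0 := by
  obtain ⟨φ, h1, h2⟩ := not_not.1 h
  have h3 : dist (b i) (p j) = dist (b i) (glide d (p j)) := by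
    rw [← dist_bgTransform hf, ← φ.dist_map]
    exact congrArg₂ dist (h1 i) (h2 j)
  have h4 := dist_sq_plane (b i) (p j)
  rw [h3, dist_sq_plane] at h4
  simp [glide] at h4
  linear_combination h4

theorem dist_bisectorPoint (d l : ℝ) (p : Plane) :
    dist (bisectorPoint p (glide d p) l) p = dist (bisectorPoint p (glide d p) l) (glide d p) := by
  rw [← sq_eq_sq₀ dist_nonneg dist_nonneg, dist_sq_plane, dist_sq_plane]
  simp [bisectorPoint, glide]
  ring

/-- A point on its own perpendicular bisector would be fixed, but a proper glide-reflection has no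
fixed points. -/
theorem bisectorPoint_ne {d : ℝ} (hd : d ≠ 0) (l : ℝ) (p : Plane) :
    bisectorPoint p (glide d p) l ≠ p := by
  intro h
  have h0 := congrArg (fun r : Plane => r 0) h
  have h1 := congrArg (fun r : Plane => r 1) h
  simp [bisectorPoint, glide] at h0 h1
  have h2 : d * (1 / 2 + 2 * l ^ 2) = 0 := by linear_combination h0 + 2 * l * h1
  have h3 : 1 / 2 + 2 * l ^ 2 ≠ 0 := by positivity
  exact (mul_ne_zero hd h3) h2

theorem pairI_generic {d f0 f1 a5 b5 a6 b6 l1 l2 l3 : ℝ} (hd : d ≠ 0) (hf : f0 ≠ 0)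
    (h12 : l1 ≠ l2) (h13 : l1 ≠ l3) (h23 : l2 ≠ l3) (h1 : f1 + 2 * f0 * l1 ≠ 0)
    (h2 : f1 + 2 * f0 * l2 ≠ 0) (h3 : f1 + 2 * f0 * l3 ≠ 0)
    (harea : a5 * (b6 - 1) - a6 * (b5 - 1) ≠ 0) {X X' : Realisation}
    (h : (X, X') = pairI d f0 f1 a5 b5 a6 b6 l1 l2 l3) :
    X.IsSetC X' ∧ X.Incongruent X' ∧ X.IsCaseI X' d f0 f1 a5 b5 a6 b6 l1 l2 l3 ∧
      (X.averaged X').HasStructure ∧ (X.averaged X').flexionOrder = 0 := by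
  obtain ⟨rfl, rfl⟩ := Prod.mk.inj h
  have hf' : f0 ≠ 0 ∨ f1 ≠ 0 := Or.inl hf
  have harea' : signedArea !₂[0, 1] !₂[a5, b5] !₂[a6, b6] ≠ 0 := by
    simpa [signedArea] using harea
  have hC : (pairI d f0 f1 a5 b5 a6 b6 l1 l2 l3).1.IsSetC
      (pairI d f0 f1 a5 b5 a6 b6 l1 l2 l3).2 := by
    refine glidePair_isSetC hf' (fun i => ?_) (fun i => ?_) ⟨0, 1, fun h0 => ?_⟩ harea'
    · fin_cases i
      exacts [bisectorPoint_ne hd _ _, bisectorPoint_ne hd _ _, bisectorPoint_ne hd _ _]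
    · fin_cases i
      exacts [dist_bisectorPoint _ _ _, dist_bisectorPoint _ _ _, dist_bisectorPoint _ _ _]
    · have := congrArg (fun r : Plane => r 1) h0
      simp [bisectorPoint, glide, hd] at this
      exact h12 this
  have hI : (pairI d f0 f1 a5 b5 a6 b6 l1 l2 l3).1.IsCaseI
      (pairI d f0 f1 a5 b5 a6 b6 l1 l2 l3).2 d f0 f1 a5 b5 a6 b6 l1 l2 l3 :=
    ⟨hf', hd, takesForm_self _⟩
  have hA : ((pairI d f0 f1 a5 b5 a6 b6 l1 l2 l3).1.averaged
      (pairI d f0 f1 a5 b5 a6 b6 l1 l2 l3).2).HasStructure := by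
    refine averaged_glidePair_hasStructure hf' ⟨fun i h0 => ?_, fun i j hij => Or.inl fun h0 => ?_⟩
    · have h5 := congrArg (fun r : Plane => r 1) h0
      have h6 : ∀ l : ℝ, f0 * (l * d) = -(d * f1 / 2) → f1 + 2 * f0 * l = 0 := fun l hl => by
        apply mul_left_cancel₀ hd
        linear_combination 2 * hl
      fin_cases i <;> simp [normalForm, bisectorPoint, glide] at h5
      exacts [h1 (h6 _ h5), h2 (h6 _ h5), h3 (h6 _ h5)]
    · have h5 := congrArg (fun r : Plane => r 1) h0
      fin_cases i <;> fin_cases j <;>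
        simp [normalForm, bisectorPoint, glide, hd, hf] at h5 hij
      exacts [h12 h5, h13 h5, h12 h5.symm, h23 h5, h13 h5.symm, h23 h5.symm]
  refine ⟨hC, ?_, hI, hA, ?_⟩
  · by_contra hinc
    have e0 := glidePair_equidistant hf' hinc 0 0
    have e1 := glidePair_equidistant hf' hinc 0 1
    have e2 := glidePair_equidistant hf' hinc 0 2
    simp only [Matrix.cons_val] at e0 e1 e2
    -- Equidistance of one base point from all three pairs puts the platform points on a line
    -- $2da+4b_1b=\mathrm{const}$, where $b_1$ is the ordinate of that base point; it is a proper
    -- line since $d\ne0$.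
    apply mul_ne_zero hd harea'
    rw [signedArea]
    simp only [Matrix.cons_val] at *
    linear_combination (b6 - 1) / 2 * (e1 - e0) - (b5 - 1) / 2 * (e2 - e0)
  · by_contra h0
    exact hf ((hI.one_le_flexionOrder_iff hC.not_collinear hA).1 (Order.one_le_iff_ne_zero.2 h0))

theorem pairIIiii_generic {f0 f1 a2 b2 a3 b3 a5 a6 l1 : ℝ} (hf : f0 ≠ 0)
    (hb2 : b2 ≠ 0) (hb3 : b3 ≠ 0) (h56 : a5 ≠ a6) (h1 : f1 + 2 * f0 * l1 ≠ 0) {X X' : Realisation}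
    (h : (X, X') = pairIIiii f0 f1 a2 b2 a3 b3 a5 a6 l1) :
    X.IsSetC X' ∧ X.Incongruent X' ∧ X.IsCaseIIiii X' f0 f1 a2 b2 a3 b3 a5 a6 l1 ∧
      (X.averaged X').HasStructure ∧ (X.averaged X').flexionOrder = 0 := by
  obtain ⟨rfl, rfl⟩ := Prod.mk.inj h
  have hf' : f0 ≠ 0 ∨ f1 ≠ 0 := Or.inl hf
  have harea' : signedArea !₂[0, 1] !₂[a5, 0] !₂[a6, 0] ≠ 0 := by
    simp only [signedArea, Matrix.cons_val]
    intro h0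
    apply h56
    linear_combination -h0
  have hC : (pairIIiii f0 f1 a2 b2 a3 b3 a5 a6 l1).1.IsSetC
      (pairIIiii f0 f1 a2 b2 a3 b3 a5 a6 l1).2 := by
    refine glidePair_isSetC hf' (fun i h0 => ?_) (fun i => ?_) ⟨0, 1, fun h0 => ?_⟩ harea'
    · have := congrArg (fun r : Plane => r 1) h0
      fin_cases i <;> simp [bisectorPoint, glide, hb2, hb3] at this
    · fin_cases i
      · exact dist_bisectorPoint _ _ _
      · simp [glide]
      · simp [glide]
    · have := congrArg (fun r : Plane => r 1) h0
      simp [bisectorPoint, glide, hb2.symm] at this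
  have hI : (pairIIiii f0 f1 a2 b2 a3 b3 a5 a6 l1).1.IsCaseIIiii
      (pairIIiii f0 f1 a2 b2 a3 b3 a5 a6 l1).2 f0 f1 a2 b2 a3 b3 a5 a6 l1 :=
    ⟨hf', takesForm_self _⟩
  have hA : ((pairIIiii f0 f1 a2 b2 a3 b3 a5 a6 l1).1.averaged
      (pairIIiii f0 f1 a2 b2 a3 b3 a5 a6 l1).2).HasStructure := by
    refine averaged_glidePair_hasStructure hf' ⟨fun i h0 => ?_, fun i j hij => ?_⟩
    · have h5 := congrArg (fun r : Plane => r 0) h0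
      have h6 := congrArg (fun r : Plane => r 1) h0
      fin_cases i
      · simp [normalForm, bisectorPoint, glide] at h5
        exact h1 (by linear_combination h5)
      · simp [normalForm, hf, hb2] at h6
      · simp [normalForm, hf, hb3] at h6
    · by_contra! h0
      have h5 := congrArg (fun r : Plane => r 1) h0.1
      have h6 := congrArg (fun r : Plane => r 0) h0.2
      fin_cases i <;> fin_cases j <;>
        simp [normalForm, bisectorPoint, glide, hf, hb2, hb3, h56,
          h56.symm] at h5 h6 hij
  refine ⟨hC, ?_, hI, hA, ?_⟩
  · by_contra hinc
    have e1 := glidePair_equidistant hf' hinc 1 0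
    simp [hb2] at e1
  · by_contra h0
    exact mul_ne_zero (mul_ne_zero hf hb2) hb3
      ((hI.one_le_flexionOrder_iff hC.not_collinear hA).1 (Order.one_le_iff_ne_zero.2 h0))

/-! ### Genericity polynomials -/

theorem exists_polynomial_pairI :
    ∃ Q : MvPolynomial (Fin 10) ℝ, Q ≠ 0 ∧
      ∀ d f0 f1 a5 b5 a6 b6 l1 l2 l3 : ℝ,
        MvPolynomial.eval ![d, f0, f1, a5, b5, a6, b6, l1, l2, l3] Q ≠ 0 →
        ∀ X X' : Realisation, (X, X') = pairI d f0 f1 a5 b5 a6 b6 l1 l2 l3 →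
          X.IsSetC X' ∧ X.Incongruent X' ∧ X.IsCaseI X' d f0 f1 a5 b5 a6 b6 l1 l2 l3 ∧
          (X.averaged X').HasStructure ∧ (X.averaged X').flexionOrder = 0 := by
  -- The factors express, in order, $d\ne0$, $f_0\ne0$, distinct base ordinates $l_id$, non-zero
  -- averaged legs, and a non-collinear platform.
  set Q : MvPolynomial (Fin 10) ℝ := X 0 * X 1 * (X 7 - X 8) * (X 7 - X 9) * (X 8 - X 9) *
    (X 2 + C 2 * X 1 * X 7) * (X 2 + C 2 * X 1 * X 8) * (X 2 + C 2 * X 1 * X 9) *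
    (X 3 * (X 6 - 1) - X 5 * (X 4 - 1)) with hQ
  have hev : ∀ d f0 f1 a5 b5 a6 b6 l1 l2 l3 : ℝ,
      MvPolynomial.eval ![d, f0, f1, a5, b5, a6, b6, l1, l2, l3] Q =
        d * f0 * (l1 - l2) * (l1 - l3) * (l2 - l3) * (f1 + 2 * f0 * l1) * (f1 + 2 * f0 * l2) *
          (f1 + 2 * f0 * l3) * (a5 * (b6 - 1) - a6 * (b5 - 1)) := by
    intros
    simp only [hQ, map_mul, map_add, map_sub, map_one, eval_X, eval_C, Matrix.cons_val]
  refine ⟨Q, fun h0 => ?_, ?_⟩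
  -- Any point where no factor vanishes shows that `Q` is non-zero.
  · have := hev 1 1 1 1 1 0 0 1 2 3
    rw [h0, map_zero] at this
    norm_num at this
  · intro d f0 f1 a5 b5 a6 b6 l1 l2 l3 hne X X' h
    rw [hev] at hne
    simp only [mul_ne_zero_iff, sub_ne_zero (a := l1), sub_ne_zero (a := l2)] at hne
    obtain ⟨⟨⟨⟨⟨⟨⟨⟨hd, hf⟩, h12⟩, h13⟩, h23⟩, h1⟩, h2⟩, h3⟩, harea⟩ := hne
    exact pairI_generic hd hf h12 h13 h23 h1 h2 h3 harea h

theorem exists_polynomial_pairIIiii :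
    ∃ Q : MvPolynomial (Fin 9) ℝ, Q ≠ 0 ∧
      ∀ f0 f1 a2 b2 a3 b3 a5 a6 l1 : ℝ,
        MvPolynomial.eval ![f0, f1, a2, b2, a3, b3, a5, a6, l1] Q ≠ 0 →
        ∀ X X' : Realisation, (X, X') = pairIIiii f0 f1 a2 b2 a3 b3 a5 a6 l1 →
          X.IsSetC X' ∧ X.Incongruent X' ∧ X.IsCaseIIiii X' f0 f1 a2 b2 a3 b3 a5 a6 l1 ∧
          (X.averaged X').HasStructure ∧ (X.averaged X').flexionOrder = 0 := by
  set Q : MvPolynomial (Fin 9) ℝ := X 0 * X 3 * X 5 * (X 6 - X 7) * (X 1 + C 2 * X 0 * X 8) with hQ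
  have hev : ∀ f0 f1 a2 b2 a3 b3 a5 a6 l1 : ℝ,
      MvPolynomial.eval ![f0, f1, a2, b2, a3, b3, a5, a6, l1] Q =
        f0 * b2 * b3 * (a5 - a6) * (f1 + 2 * f0 * l1) := by
    intros
    simp only [hQ, map_mul, map_add, map_sub, eval_X, eval_C, Matrix.cons_val]
  refine ⟨Q, fun h0 => ?_, ?_⟩
  · have := hev 1 1 1 1 1 1 1 0 1
    rw [h0, map_zero] at this
    norm_num at this
  · intro f0 f1 a2 b2 a3 b3 a5 a6 l1 hne X X' h
    rw [hev] at hne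
    simp only [mul_ne_zero_iff, sub_ne_zero (a := a5)] at hne
    obtain ⟨⟨⟨⟨hf, hb2⟩, hb3⟩, h56⟩, h1⟩ := hne
    exact pairIIiii_generic hf hb2 hb3 h56 h1 h

/-! ### Classification of the pairs of Set C -/

/-- Half-angle parameters, taken from a complex square root. -/
theorem exists_sqrt_of_unit {c s : ℝ} (h : c ^ 2 + s ^ 2 = 1) :
    ∃ a b : ℝ, a ^ 2 + b ^ 2 = 1 ∧ a ^ 2 - b ^ 2 = c ∧ 2 * a * b = s := by
  obtain ⟨z, hz⟩ := IsAlgClosed.exists_pow_nat_eq (⟨c, s⟩ : ℂ) two_pos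
  have h0 := congrArg Complex.re hz
  have h1 := congrArg Complex.im hz
  simp [pow_two] at h0 h1
  refine ⟨z.re, z.im, ?_, by linarith, by linarith⟩
  have h2 : (z.re ^ 2 + z.im ^ 2) ^ 2 = 1 := by
    rw [← h, ← h0, ← h1]
    ring
  exact (pow_eq_one_iff_of_nonneg (by positivity) two_ne_zero).1 h2

theorem bgTransform_eq_of_unit {c s f0 f1 : ℝ} (hf : f0 ^ 2 + f1 ^ 2 = 1)
    (hc : f0 ^ 2 - f1 ^ 2 = c) (hs : 2 * f0 * f1 = -s) (q : Plane) :
    bgTransform f0 f1 0 0 q = !₂[c * q 0 + s * q 1, c * q 1 - s * q 0] := by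
  apply plane_ext <;> simp [bgTransform, hf, hc, hs]
  ring

/-- The signed distance, up to the unit length, of `x` to the axis of the glide-reflection. -/
def axisForm (c s u v w1 w2 g1 g2 : ℝ) (x : Plane) : ℝ :=
  (s * g1 + c * g2) * x 0 + (c * g1 - s * g2) * x 1 + (g2 * (u - w1) + g1 * (v - w2)) / 2

/-- With $\theta=c+is$ and $\gamma=g_1+ig_2$, the linear part of $\beta\alpha^{-1}$ is
$z\mapsto\theta(C+iS)\bar z$. Turning the frame by $\gamma$ multiplies the coefficient by
$\gamma^2$, so $\gamma^2$ must be its conjugate for the axis to become horizontal. The scale is the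
inverse height of the first platform point over the axis. -/
theorem exists_takesForm_of_coords {X X' : Realisation} {c s u v C S w1 w2 g1 g2 : ℝ}
    (hcs : c ^ 2 + s ^ 2 = 1) (hCS : C ^ 2 + S ^ 2 = 1) (hg : g1 ^ 2 + g2 ^ 2 = 1)
    (hG1 : g1 ^ 2 - g2 ^ 2 = c * C - s * S) (hG2 : 2 * g1 * g2 = -(c * S + s * C))
    (hb : ∀ i, X'.base i = similarity c s u v (X.base i))
    (hp : ∀ i, X'.platform i = !₂[w1 + C * X.platform i 0 + S * X.platform i 1,
      w2 + S * X.platform i 0 - C * X.platform i 1]) (σ : Equiv.Perm (Fin 3))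
    (hρ : 0 < axisForm c s u v w1 w2 g1 g2 (X.platform (σ 0))) :
    ∃ (d f0 f1 k : ℝ) (b p : Fin 3 → Plane), (f0 ≠ 0 ∨ f1 ≠ 0) ∧ 0 < k ∧ p 0 = !₂[0, 1] ∧
      (∀ i, p i 1 = k * axisForm c s u v w1 w2 g1 g2 (X.platform (σ i))) ∧
      X.TakesForm X' (glidePair d f0 f1 b p) := by
  obtain ⟨f0, f1, hf, hfc, hfs⟩ := exists_sqrt_of_unit (c := c) (s := -s) (by rw [neg_sq]; exact hcs)
  set ρ := axisForm c s u v w1 w2 g1 g2 (X.platform (σ 0)) with hρd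
  set k := ρ⁻¹ with hk
  have hk0 : 0 < k := inv_pos.2 hρ
  have hkρ : k * ρ = 1 := inv_mul_cancel₀ hρ.ne'
  -- Together with `hr2` this says that $\gamma(C+iS)$ is the conjugate of $\gamma\theta$.
  have hr1 : g1 * C - g2 * S = c * g1 - s * g2 := by
    linear_combination -(g1 * C - g2 * S) * hg + (g1 * C + g2 * S) * hG1
      - (g1 * S - g2 * C) * hG2 + (c * g1 - s * g2) * hCS
  have hr2 : g1 * S + g2 * C = -(c * g2 + s * g1) := by
    linear_combination -(g1 * S + g2 * C) * hg + (g1 * C + g2 * S) * hG2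
      + (g1 * S - g2 * C) * hG1 - (c * g2 + s * g1) * hCS
  -- Here `y1` gives the first platform point abscissa 0, `y2` moves the glide axis to ordinate 0,
  -- and `d` is the resulting translation distance.
  set y1 : ℝ := -(k * ((c * g1 - s * g2) * X.platform (σ 0) 0
    - (s * g1 + c * g2) * X.platform (σ 0) 1)) with hy1
  set y2 : ℝ := k * (g2 * (u - w1) + g1 * (v - w2)) / 2 with hy2
  set d : ℝ := -(k * (g1 * (u - w1) - g2 * (v - w2))) with hd
  set U1 := c * y1 + s * y2 with hU1
  set U2 := c * y2 - s * y1 with hU2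
  set W1 := y1 - k * (g1 * u - g2 * v) with hW1
  set W2 := y2 - k * (g2 * u + g1 * v) with hW2
  -- The two realisations need different translations `U` and `W`: half the sum belongs to the
  -- common frame, half the difference to the opposite translations.
  obtain ⟨φ, hφ, hφc⟩ := exists_isDirect hg ((U1 + W1) / (2 * k)) ((U2 + W2) / (2 * k))
  have e1 : k * ((U1 + W1) / (2 * k)) = (U1 + W1) / 2 := by field_simp
  have e2 : k * ((U2 + W2) / (2 * k)) = (U2 + W2) / 2 := by field_simp
  refine ⟨d, f0, f1, k,
    fun i => !₂[k * (g1 * X'.base (σ i) 0 - g2 * X'.base (σ i) 1) + W1,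
      k * (g2 * X'.base (σ i) 0 + g1 * X'.base (σ i) 1) + W2],
    fun i => !₂[k * ((c * g1 - s * g2) * X.platform (σ i) 0
        - (s * g1 + c * g2) * X.platform (σ i) 1) + y1,
      k * ((s * g1 + c * g2) * X.platform (σ i) 0
        + (c * g1 - s * g2) * X.platform (σ i) 1) + y2], ?_, hk0, ?_, fun i => ?_,
    σ, φ, k, !₂[(U1 - W1) / 2, (U2 - W2) / 2], hφ, hk0, fun i => ?_, fun i => ?_, fun i => ?_,
    fun i => ?_⟩
  · by_contra! h
    rw [h.1, h.2] at hf
    norm_num at hf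
  · apply plane_ext
    · simp [hy1]
    · simp [hy2]
      rw [hρd, axisForm] at hkρ
      linear_combination hkρ
  · simp [hy2, axisForm]
    ring
  · rw [hφc]
    simp only [glidePair, bgTransform_eq_of_unit hf hfc hfs, hb]
    apply plane_ext
    · simp [similarity]
      linear_combination e1 + hU1 - c * hW1 - s * hW2
        + (-k * (g1 * X.base (σ i) 0 - g2 * X.base (σ i) 1)) * hcs
    · simp [similarity]
      linear_combination e2 + hU2 - c * hW2 + s * hW1
        + (-k * (g2 * X.base (σ i) 0 + g1 * X.base (σ i) 1)) * hcs
  · rw [hφc]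
    simp only [glidePair, bgTransform_eq_of_unit hf hfc hfs]
    apply plane_ext
    · simp [similarity]
      linear_combination e1 + hU1
        + (-k * (g1 * X.platform (σ i) 0 - g2 * X.platform (σ i) 1)) * hcs
    · simp [similarity]
      linear_combination e2 + hU2
        + (-k * (g2 * X.platform (σ i) 0 + g1 * X.platform (σ i) 1)) * hcs
  · rw [hφc]
    apply plane_ext
    · simp [similarity, glidePair]
      linear_combination e1
    · simp [similarity, glidePair]
      linear_combination e2
  · rw [hφc, hp]
    apply plane_ext
    · simp [similarity, glidePair, glide]
      linear_combination e1 + hW1 - hd + k * X.platform (σ i) 0 * hr1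
        + k * X.platform (σ i) 1 * hr2
    · simp [similarity, glidePair, glide]
      linear_combination e2 + hW2 + 2 * hy2 + k * X.platform (σ i) 0 * hr2
        - k * X.platform (σ i) 1 * hr1

theorem axisForm_neg (c s u v w1 w2 g1 g2 : ℝ) (x : Plane) :
    axisForm c s u v w1 w2 (-g1) (-g2) x = -axisForm c s u v w1 w2 g1 g2 x := by
  simp only [axisForm]
  ring

/-- The form is affine with gradient of unit length, so its zeros lie on a line. -/
theorem exists_axisForm_ne_zero {c s u v w1 w2 g1 g2 : ℝ} (hcs : c ^ 2 + s ^ 2 = 1)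
    (hg : g1 ^ 2 + g2 ^ 2 = 1) {f : Fin 3 → Plane} (hf : ¬ Collinear ℝ (Set.range f)) :
    ∃ i, axisForm c s u v w1 w2 g1 g2 (f i) ≠ 0 := by
  by_contra! h
  apply hf
  have h0 := h 0
  have h1 := h 1
  have h2 := h 2
  rw [axisForm] at h0 h1 h2
  rw [collinear_range_iff, signedArea]
  have hm : (s * g1 + c * g2) ^ 2 + (c * g1 - s * g2) ^ 2 = 1 := by
    linear_combination (g1 ^ 2 + g2 ^ 2) * hcs + hg
  linear_combination -((f 1 0 - f 0 0) * (f 2 1 - f 0 1) - (f 2 0 - f 0 0) * (f 1 1 - f 0 1)) * hm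
    + ((s * g1 + c * g2) * (f 2 1 - f 0 1) - (c * g1 - s * g2) * (f 2 0 - f 0 0)) * (h1 - h0)
    - ((s * g1 + c * g2) * (f 1 1 - f 0 1) - (c * g1 - s * g2) * (f 1 0 - f 0 0)) * (h2 - h0)

/-- The legs are ordered with the off-axis platform points first, as the normal forms of the
reflection cases require. -/
theorem exists_perm_of_ne_zero {ρ : Fin 3 → ℝ} (h : ∃ i, ρ i ≠ 0) :
    ∃ σ : Equiv.Perm (Fin 3), ρ (σ 0) ≠ 0 ∧ (ρ (σ 1) = 0 → ρ (σ 2) = 0) := by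
  by_cases h0 : ρ 0 = 0
  · by_cases h2 : ρ 2 = 0
    · refine ⟨Equiv.swap 0 1, ?_, fun _ => ?_⟩
      · obtain ⟨i, hi⟩ := h
        fin_cases i
        exacts [absurd h0 hi, by simpa using hi, absurd h2 hi]
      · rwa [Equiv.swap_apply_of_ne_of_ne (by decide) (by decide)]
    · exact ⟨Equiv.swap 0 2, by simpa using h2, fun _ => by simpa using h0⟩
  · by_cases h1 : ρ 1 = 0
    · refine ⟨Equiv.swap 1 2, ?_, fun _ => by simpa using h1⟩
      rwa [Equiv.swap_apply_of_ne_of_ne (by decide) (by decide)]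
    · exact ⟨1, by simpa using h0, fun h => absurd h (by simpa using h1)⟩

/-- Both square roots of the required $\gamma^2$ make the axis horizontal; the sign is chosen so
that the first platform point lies above it. -/
theorem IsSetC.exists_takesForm {X X' : Realisation} (h : X.IsSetC X') :
    ∃ (d f0 f1 : ℝ) (b p : Fin 3 → Plane), (f0 ≠ 0 ∨ f1 ≠ 0) ∧ p 0 = !₂[0, 1] ∧
      (p 1 1 = 0 → p 2 1 = 0) ∧ X.TakesForm X' (glidePair d f0 f1 b p) := by
  obtain ⟨α, hα, hb⟩ := h.exists_direct
  obtain ⟨β, hβ, hp⟩ := h.exists_indirect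
  obtain ⟨c, s, u, v, hcs, hα'⟩ := hα.exists_eq_similarity
  obtain ⟨C, S, w1, w2, hCS, hβ'⟩ := hβ.exists_coords
  obtain ⟨g1, g2, hg, hG1, hG2⟩ := exists_sqrt_of_unit (c := c * C - s * S) (s := -(c * S + s * C))
    (by linear_combination (C ^ 2 + S ^ 2) * hcs + hCS)
  obtain ⟨σ, h0, h12⟩ := exists_perm_of_ne_zero
    (exists_axisForm_ne_zero (u := u) (v := v) (w1 := w1) (w2 := w2) hcs hg h.not_collinear)
  have hb' : ∀ i, X'.base i = similarity c s u v (X.base i) := fun i => by rw [← hb, hα']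
  have hp' : ∀ i, X'.platform i = !₂[w1 + C * X.platform i 0 + S * X.platform i 1,
      w2 + S * X.platform i 0 - C * X.platform i 1] := fun i => by rw [← hp, hβ']
  rcases lt_or_gt_of_ne h0 with hneg | hpos
  · obtain ⟨d, f0, f1, k, b, p, hf, hk, hp0, hpi, hT⟩ := exists_takesForm_of_coords (g1 := -g1)
      (g2 := -g2) hcs hCS (by rw [neg_sq, neg_sq]; exact hg) (by rw [neg_sq, neg_sq]; exact hG1)
      (by rw [← hG2]; ring) hb' hp' σ (by rw [axisForm_neg]; exact neg_pos.2 hneg)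
    refine ⟨d, f0, f1, b, p, hf, hp0, ?_, hT⟩
    rw [hpi, hpi, axisForm_neg, axisForm_neg]
    simpa [hk.ne'] using h12
  · obtain ⟨d, f0, f1, k, b, p, hf, hk, hp0, hpi, hT⟩ := exists_takesForm_of_coords hcs hCS hg hG1
      hG2 hb' hp' σ hpos
    refine ⟨d, f0, f1, b, p, hf, hp0, ?_, hT⟩
    rw [hpi, hpi]
    simpa [hk.ne'] using h12

theorem TakesForm.dist_eq {X X' : Realisation} {d f0 f1 : ℝ} {b p : Fin 3 → Plane}
    (hf : f0 ≠ 0 ∨ f1 ≠ 0) (hT : X.TakesForm X' (glidePair d f0 f1 b p))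
    (hlegs : ∀ i, dist (X.base i) (X.platform i) = dist (X'.base i) (X'.platform i)) (i : Fin 3) :
    dist (b i) (p i) = dist (b i) (glide d (p i)) := by
  obtain ⟨σ, g, k, t, -, -, h1, h2, h3, h4⟩ := hT
  rw [← dist_bgTransform hf]
  change dist ((glidePair d f0 f1 b p).1.base i) ((glidePair d f0 f1 b p).1.platform i) =
    dist ((glidePair d f0 f1 b p).2.base i) ((glidePair d f0 f1 b p).2.platform i)
  rw [← h1, ← h2, ← h3, ← h4, dist_add_right, dist_sub_right, dist_smul₀, dist_smul₀, g.dist_map,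
    g.dist_map, hlegs]

/-- Equidistance puts `b` on the perpendicular bisector, which is a line exactly because `p` is not
fixed. -/
theorem exists_eq_bisectorPoint {d : ℝ} {b p : Plane} (h : dist b p = dist b (glide d p))
    (hne : d ≠ 0 ∨ p 1 ≠ 0) : ∃ l, b = bisectorPoint p (glide d p) l := by
  have h4 := dist_sq_plane b p
  rw [h, dist_sq_plane] at h4
  simp [glide] at h4
  have hn : 4 * p 1 ^ 2 + d ^ 2 ≠ 0 := by
    rcases hne with hne | hne <;> positivity
  -- With $n=(2p_1,d)$ and midpoint $m$, this is $l=\langle n,b-m\rangle/\|n\|^2$.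
  obtain ⟨l, hl⟩ : ∃ l, l * (4 * p 1 ^ 2 + d ^ 2) = 2 * p 1 * (b 0 - p 0 - d / 2) + d * b 1 :=
    ⟨_, div_mul_cancel₀ _ hn⟩
  refine ⟨l, plane_ext ?_ ?_⟩
  · apply mul_left_cancel₀ hn
    simp [bisectorPoint, glide, -mul_eq_mul_left_iff]
    linear_combination (-d / 2) * h4 - 2 * p 1 * hl
  · apply mul_left_cancel₀ hn
    simp [bisectorPoint, glide, -mul_eq_mul_left_iff]
    linear_combination p 1 * h4 - d * hl

/-- Equal leg lengths put each base point on the bisector of its platform point and its image,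
except where $d=0$ and the platform point is on the axis: then the condition is void and the base
point is free. The cases count such legs. -/
theorem IsSetC.classification {X X' : Realisation} (h : X.IsSetC X') :
    (∃ d f0 f1 a5 b5 a6 b6 l1 l2 l3 : ℝ, X.IsCaseI X' d f0 f1 a5 b5 a6 b6 l1 l2 l3) ∨
    (∃ f0 f1 a5 b5 a6 b6 l1 l2 l3 : ℝ, X.IsCaseIIi X' f0 f1 a5 b5 a6 b6 l1 l2 l3) ∨
    (∃ f0 f1 a3 b3 a5 b5 a6 l1 l2 : ℝ, X.IsCaseIIii X' f0 f1 a3 b3 a5 b5 a6 l1 l2) ∨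
    (∃ f0 f1 a2 b2 a3 b3 a5 a6 l1 : ℝ, X.IsCaseIIiii X' f0 f1 a2 b2 a3 b3 a5 a6 l1) := by
  obtain ⟨d, f0, f1, b, p, hf, hp0, hp12, hT⟩ := h.exists_takesForm
  have hdist := hT.dist_eq hf h.legs
  have vec : ∀ q : Fin 3 → Plane, q = ![q 0, q 1, q 2] := fun q => by
    ext i : 1
    fin_cases i <;> rfl
  have coord : ∀ q : Plane, q = !₂[q 0, q 1] := fun q => plane_ext rfl rfl
  have coord0 : ∀ q : Plane, q 1 = 0 → q = !₂[q 0, 0] := fun q hq => plane_ext rfl hq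
  obtain ⟨l1, h1⟩ := exists_eq_bisectorPoint (hdist 0) (Or.inr (by rw [hp0]; simp))
  have gen : ∀ l2 l3, b 1 = bisectorPoint (p 1) (glide d (p 1)) l2 →
      b 2 = bisectorPoint (p 2) (glide d (p 2)) l3 →
      X.TakesForm X' (pairI d f0 f1 (p 1 0) (p 1 1) (p 2 0) (p 2 1) l1 l2 l3) := by
    intro l2 l3 h2 h3
    rw [vec b, vec p, h1, h2, h3, hp0] at hT
    rw [pairI, ← coord, ← coord]
    exact hT
  by_cases hd : d = 0
  · subst hd
    right
    by_cases hp1 : p 1 1 = 0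
    · right; right
      refine ⟨f0, f1, b 1 0, b 1 1, b 2 0, b 2 1, p 1 0, p 2 0, l1, hf, ?_⟩
      rw [vec b, vec p, h1, hp0] at hT
      rw [pairIIiii, ← coord, ← coord, ← coord0 _ hp1, ← coord0 _ (hp12 hp1)]
      exact hT
    · obtain ⟨l2, h2⟩ := exists_eq_bisectorPoint (hdist 1) (Or.inr hp1)
      by_cases hp2 : p 2 1 = 0
      · right; left
        refine ⟨f0, f1, b 2 0, b 2 1, p 1 0, p 1 1, p 2 0, l1, l2, hf, hp1, ?_⟩
        rw [vec b, vec p, h1, h2, hp0] at hT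
        rw [pairIIii, ← coord, ← coord, ← coord0 _ hp2]
        exact hT
      · left
        obtain ⟨l3, h3⟩ := exists_eq_bisectorPoint (hdist 2) (Or.inr hp2)
        exact ⟨f0, f1, _, _, _, _, l1, l2, l3, hf, hp1, hp2, gen l2 l3 h2 h3⟩
  · left
    obtain ⟨l2, h2⟩ := exists_eq_bisectorPoint (hdist 1) (Or.inl hd)
    obtain ⟨l3, h3⟩ := exists_eq_bisectorPoint (hdist 2) (Or.inl hd)
    exact ⟨d, f0, f1, _, _, _, _, l1, l2, l3, hf, hd, gen l2 l3 h2 h3⟩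

end Realisation

end

theorem mainTheorem2 :
    -- every pair of Set C is, up to the normalisation, in one of the four parametrised cases
    (∀ X X' : Realisation, X.IsSetC X' →
      (∃ d f0 f1 a5 b5 a6 b6 l1 l2 l3 : ℝ, X.IsCaseI X' d f0 f1 a5 b5 a6 b6 l1 l2 l3) ∨
      (∃ f0 f1 a5 b5 a6 b6 l1 l2 l3 : ℝ, X.IsCaseIIi X' f0 f1 a5 b5 a6 b6 l1 l2 l3) ∨
      (∃ f0 f1 a3 b3 a5 b5 a6 l1 l2 : ℝ, X.IsCaseIIii X' f0 f1 a3 b3 a5 b5 a6 l1 l2) ∨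
      (∃ f0 f1 a2 b2 a3 b3 a5 a6 l1 : ℝ, X.IsCaseIIiii X' f0 f1 a2 b2 a3 b3 a5 a6 l1)) ∧
    -- case I: generic first-order rigidity
    (∃ Q : MvPolynomial (Fin 10) ℝ, Q ≠ 0 ∧
      ∀ d f0 f1 a5 b5 a6 b6 l1 l2 l3 : ℝ,
        MvPolynomial.eval ![d, f0, f1, a5, b5, a6, b6, l1, l2, l3] Q ≠ 0 →
        ∀ X X' : Realisation, (X, X') = pairI d f0 f1 a5 b5 a6 b6 l1 l2 l3 →
          X.IsSetC X' ∧ X.Incongruent X' ∧ X.IsCaseI X' d f0 f1 a5 b5 a6 b6 l1 l2 l3 ∧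
          (X.averaged X').HasStructure ∧ (X.averaged X').flexionOrder = 0) ∧
    -- case I: flexion order at least 1
    (∀ (X X' : Realisation) (d f0 f1 a5 b5 a6 b6 l1 l2 l3 : ℝ),
      X.IsSetC X' → (X.averaged X').HasStructure →
      X.IsCaseI X' d f0 f1 a5 b5 a6 b6 l1 l2 l3 →
        (1 ≤ (X.averaged X').flexionOrder ↔ f0 = 0)) ∧
    -- case II_iii: generic first-order rigidity
    (∃ Q : MvPolynomial (Fin 9) ℝ, Q ≠ 0 ∧
      ∀ f0 f1 a2 b2 a3 b3 a5 a6 l1 : ℝ,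
        MvPolynomial.eval ![f0, f1, a2, b2, a3, b3, a5, a6, l1] Q ≠ 0 →
        ∀ X X' : Realisation, (X, X') = pairIIiii f0 f1 a2 b2 a3 b3 a5 a6 l1 →
          X.IsSetC X' ∧ X.Incongruent X' ∧ X.IsCaseIIiii X' f0 f1 a2 b2 a3 b3 a5 a6 l1 ∧
          (X.averaged X').HasStructure ∧ (X.averaged X').flexionOrder = 0) ∧
    -- case II_iii: flexion order at least 1
    (∀ (X X' : Realisation) (f0 f1 a2 b2 a3 b3 a5 a6 l1 : ℝ),
      X.IsSetC X' → (X.averaged X').HasStructure →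
      X.IsCaseIIiii X' f0 f1 a2 b2 a3 b3 a5 a6 l1 →
        (1 ≤ (X.averaged X').flexionOrder ↔ f0 * b2 * b3 = 0)) ∧
    -- case II_i
    (∀ (X X' : Realisation) (f0 f1 a5 b5 a6 b6 l1 l2 l3 : ℝ),
      X.IsSetC X' → (X.averaged X').HasStructure →
      X.IsCaseIIi X' f0 f1 a5 b5 a6 b6 l1 l2 l3 →
        1 ≤ (X.averaged X').flexionOrder ∧
        Collinear ℝ (Set.range (X.averaged X').base ∪ Set.range (X.averaged X').platform) ∧
        (X.averaged X').IsSingularPoint) ∧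
    -- case II_ii
    (∀ (X X' : Realisation) (f0 f1 a3 b3 a5 b5 a6 l1 l2 : ℝ),
      X.IsSetC X' → (X.averaged X').HasStructure →
      X.IsCaseIIii X' f0 f1 a3 b3 a5 b5 a6 l1 l2 →
        1 ≤ (X.averaged X').flexionOrder ∧
        (¬ (X.averaged X').IsSingularPoint →
          (2 ≤ (X.averaged X').flexionOrder ↔ polyIIii f0 f1 a5 b5 a6 l1 l2 = 0))) := by
  refine ⟨fun X X' h => h.classification, Realisation.exists_polynomial_pairI,
    fun X X' d f0 f1 a5 b5 a6 b6 l1 l2 l3 h hA hI => hI.one_le_flexionOrder_iff h.not_collinear hA,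
    Realisation.exists_polynomial_pairIIiii,
    fun X X' f0 f1 a2 b2 a3 b3 a5 a6 l1 h hA hI => hI.one_le_flexionOrder_iff h.not_collinear hA,
    fun X X' f0 f1 a5 b5 a6 b6 l1 l2 l3 _ _ hI => hI.conclusion,
    fun X X' f0 f1 a3 b3 a5 b5 a6 l1 l2 _ hA hI => hI.conclusion hA⟩
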